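/- Conventions. Banach algebras are complex, need not be unital, and satisfy $\|xy\|\le\|x\|\,\|y\|$; a unital Banach algebra has an identity of norm $1$. A state of a unital Banach algebra $B$ is a functional $\varphi\in B^*$ with $\|\varphi\|=\varphi(1)=1$. If a unital Banach algebra $B$ contains $A$ isometrically as a subalgebra (for example if $B$ is a unitization of $A$), let $\mathfrak r^B_A=\{a\in A:\operatorname{Re}\varphi(a)\ge 0\text{ for every state }\varphi\text{ of }B\}$, and let $\mathfrak r_A=\bigcup_B\mathfrak r^B_A$, the union over all such $B$. For $x\in\mathfrak r_A$, $x^{1/n}$ is the principal $n$th root, that is $x^{1/1}=x$ and $x^{r}=\frac{\sin(r\pi)}{\pi}\int_0^\infty s^{r-1}(s+x)^{-1}x\,ds$ for $0<r<1$ (an element of $A$ that does not depend on $B$). Fix a Banach limit $\mathrm{LIM}$; the support $s(x)\in A^{**}$ is given by $s(x)(f)=\mathrm{LIM}_n f(x^{1/n})$ for $f\in A^*$. A mixed identity for $A^{**}$ is an element that is a right identity for the first Arens product and a left identity for the second. A bai (resp. cai) is a two-sided bounded (resp. contractive) approximate identity. Theorem (Aarnes--Kadison type theorem). Let $A$ be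 a Banach algebra. The following are equivalent: (i) there is $x\in\mathfrak r_A$ with $A=\overline{xAx}$; (ii) there is $x\in\mathfrak r_A$ with $A=\overline{xA}=\overline{Ax}$; (iii) there is $x\in\mathfrak r_A$ such that $s(x)$ is a mixed identity for $A^{**}$. Let $B$ be a unital Banach algebra containing $A$ isometrically as a subalgebra, for example a unitization of $A$. Then each of (i), (ii), (iii) with $x\in\mathfrak r^B_A$ in place of $x\in\mathfrak r_A$ is equivalent to (iv) $A$ has a sequential bai from $\mathfrak r^B_A$. If $x\in\mathfrak r^B_A$ satisfies one of the conditions in (i), (ii), (iii), then $(x^{1/n})_{n\ge1}$ is a sequential bai for $A$ from $\mathfrak r^B_A$, and its elements commute. If $A$ is separable and has a bai in $\mathfrak r^B_A$, then $A$ satisfies (iv), and (i)--(iii) both with $x\in\mathfrak r^B_A$ and with $x\in\mathfrak r_A$. Suppose moreover that $B$ is a unital operator algebra, that is, it has an isometric unital representation on a Hilbert space (so that $A$ is an operator algebra and $B$ contains its operator algebra unitization). Then any of (i)--(iv), with $x\in\mathfrak r^B_A$, implies that (v) $A$ has a strictly real positive element, that is, an $x\in A$ with $\operatorname{Re}\varphi(x)>0$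 for every state $\varphi$ of $B$ that does not vanish on $A$, and that $A$ has a sequential cai in $\mathfrak r^B_A$. If $A$ is approximately unital (that is, has a cai), then (i)--(iv), with $x\in\mathfrak r^B_A$, are each equivalent to (v). -/

import Mathlib

universe u v w

open Filter Topology

namespace RealPos

noncomputable section

/-! ### Numerical range and real positive elements -/

section RealPositive

/-- A state of a unital Banach algebra: a functional of norm one with value one at the unit. -/
def IsState {B : Type u} [NormedRing B] [NormedAlgebra ℂ B] (φ : StrongDual ℂ B) : Prop :=
  ‖φ‖ = 1 ∧ φ 1 = 1

/-- `𝔯_A^B`: the elements of `A` whose numerical range in `B` lies in the closed right half plane,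
where `ι` is the inclusion of `A` in the unital algebra `B`. -/
def realPositiveIn {A : Type u} {B : Type v} [NonUnitalNormedRing A] [NormedSpace ℂ A]
    [NormedRing B] [NormedAlgebra ℂ B] (ι : A →ₙₐ[ℂ] B) : Set A :=
  {a | ∀ φ : StrongDual ℂ B, IsState φ → 0 ≤ (φ (ι a)).re}

/-- `𝔯_A`: the union of the sets `𝔯_A^B` over all unital Banach algebras `B` (with unit of norm
one) that contain `A` isometrically. Since only the subalgebra `A + ℂ 1` of `B` matters, nothing is
lost by taking `B` in the universe of `A`. -/
def realPositive (A : Type u) [NonUnitalNormedRing A] [NormedSpace ℂ A] : Set A :=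
  {a | ∃ (B : Type u) (_ : NormedRing B) (_ : NormedAlgebra ℂ B) (_ : NormOneClass B)
    (_ : CompleteSpace B) (ι : A →ₙₐ[ℂ] B), Isometry ι ∧ a ∈ realPositiveIn ι}

/-- `x` is strictly real positive: `Re φ(x) > 0` for all states `φ` of the unital algebra `B`
containing `A` that do not vanish on `A`. -/
def IsStrictlyRealPositive {A : Type u} {B : Type v} [NonUnitalNormedRing A] [NormedSpace ℂ A]
    [NormedRing B] [NormedAlgebra ℂ B] (ι : A →ₙₐ[ℂ] B) (x : A) : Prop :=
  ∀ φ : StrongDual ℂ B, IsState φ → (∃ a : A, φ (ι a) ≠ 0) → 0 < (φ (ι x)).re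

end RealPositive

/-! ### Approximate identities -/

section ApproximateIdentity

variable {A : Type u} [NonUnitalNormedRing A]

/-- There is a (two-sided) bounded approximate identity consisting of elements of `S`. -/
def HasBaiIn (S : Set A) : Prop :=
  ∃ l : Filter A, l.IsApproximateUnit ∧ S ∈ l ∧ ∃ C : ℝ, ∀ᶠ e in l, ‖e‖ ≤ C

variable (A) in
/-- `A` is approximately unital: it has a (two-sided) contractive approximate identity. -/
def HasCai : Prop :=
  ∃ l : Filter A, l.IsApproximateUnit ∧ ∀ᶠ e in l, ‖e‖ ≤ 1

/-- The sequence `e` is a (two-sided) bounded approximate identity from `S`. -/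
def IsSeqBaiIn (S : Set A) (e : ℕ → A) : Prop :=
  (∀ n, e n ∈ S) ∧ (∃ C : ℝ, ∀ n, ‖e n‖ ≤ C) ∧
    ∀ a : A, Tendsto (fun n => e n * a) atTop (𝓝 a) ∧ Tendsto (fun n => a * e n) atTop (𝓝 a)

/-- The sequence `e` is a (two-sided) contractive approximate identity from `S`. -/
def IsSeqCaiIn (S : Set A) (e : ℕ → A) : Prop :=
  (∀ n, e n ∈ S) ∧ (∀ n, ‖e n‖ ≤ 1) ∧
    ∀ a : A, Tendsto (fun n => e n * a) atTop (𝓝 a) ∧ Tendsto (fun n => a * e n) atTop (𝓝 a)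

end ApproximateIdentity

/-! ### Roots -/

section Roots

variable {A : Type u} [NonUnitalNormedRing A] [NormedSpace ℂ A] [IsScalarTower ℂ A A]
  [SMulCommClass ℂ A A]

/-- The element `(s + x)⁻¹ x` of `A`, where `s` is a scalar and the inverse is taken in the algebra
obtained from `A` by adjoining a unit. -/
def resolventMul (x : A) (s : ℝ) : A :=
  (Ring.inverse (algebraMap ℂ (Unitization ℂ A) (s : ℂ) + (x : Unitization ℂ A)) *
    (x : Unitization ℂ A)).snd

/-- The principal power `x ^ r`, for `0 < r ≤ 1` and `x` real positive, by Balakrishnan's formula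
`x ^ r = (sin (r π) / π) ∫₀^∞ s ^ (r - 1) (s + x)⁻¹ x ds` if `r < 1`. -/
def principalPow (x : A) (r : ℝ) : A :=
  if r = 1 then x
  else (Real.sin (r * Real.pi) / Real.pi) •
    ∫ s in Set.Ioi (0 : ℝ), s ^ (r - 1) • resolventMul x s

/-- The sequence `x, x ^ (1/2), x ^ (1/3), …` of principal roots of `x`. -/
def rootSeq (x : A) (n : ℕ) : A :=
  principalPow x (1 / ((n : ℝ) + 1))

end Roots

/-! ### The second dual -/

section Bidual

/-- A Banach limit on the bounded complex sequences: a shift invariant functional of norm one that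
extends the limit of convergent sequences. -/
structure BanachLimit where
  toCLM : BoundedContinuousFunction ℕ ℂ →L[ℂ] ℂ
  norm_eq_one : ‖toCLM‖ = 1
  shift_eq : ∀ f g : BoundedContinuousFunction ℕ ℂ, (∀ n, g n = f (n + 1)) → toCLM g = toCLM f
  eq_of_tendsto : ∀ (f : BoundedContinuousFunction ℕ ℂ) (z : ℂ),
    Tendsto (fun n => f n) atTop (𝓝 z) → toCLM f = z

variable {A : Type u} [NonUnitalNormedRing A] [NormedSpace ℂ A]

/-- The operator that takes a functional `f` to the bounded sequence `n ↦ f (a n)`. -/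
def evalSeq (a : ℕ → A) (C : ℝ) (ha : ∀ n, ‖a n‖ ≤ C) :
    StrongDual ℂ A →L[ℂ] BoundedContinuousFunction ℕ ℂ :=
  LinearMap.mkContinuous
    { toFun := fun f => BoundedContinuousFunction.ofNormedAddCommGroupDiscrete
        (fun n => f (a n)) (C * ‖f‖) fun n => by
          rw [mul_comm]
          exact (f.le_opNorm (a n)).trans (mul_le_mul_of_nonneg_left (ha n) (norm_nonneg f))
      map_add' := fun f g => by ext n; rfl
      map_smul' := fun c f => by ext n; rfl } C fun f => by
    have hC : 0 ≤ C := (norm_nonneg _).trans (ha 0)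
    refine (BoundedContinuousFunction.norm_le (mul_nonneg hC (norm_nonneg f))).2 fun n => ?_
    rw [mul_comm]
    exact (f.le_opNorm (a n)).trans (mul_le_mul_of_nonneg_left (ha n) (norm_nonneg f))

open Classical in
/-- The weak* Banach limit of a bounded sequence in `A`, as an element of `A**`:
its value at `f` is `LIM_n f (a n)`. (It is `0` by convention for unbounded sequences.) -/
def weakStarLim (LIM : BanachLimit) (a : ℕ → A) : StrongDual ℂ (StrongDual ℂ A) :=
  if h : ∃ C : ℝ, ∀ n, ‖a n‖ ≤ C then LIM.toCLM.comp (evalSeq a h.choose h.choose_spec) else 0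

variable [IsScalarTower ℂ A A] [SMulCommClass ℂ A A]

/-- The support idempotent `s(x)`: the weak* Banach limit of the roots `x ^ (1/n)`. -/
def support (LIM : BanachLimit) (x : A) : StrongDual ℂ (StrongDual ℂ A) :=
  weakStarLim LIM (rootSeq x)

variable (A) in
/-- The map that takes `f` to `a ↦ (b ↦ f (a * b))`. -/
def dualMulLeft : StrongDual ℂ A →L[ℂ] A →L[ℂ] StrongDual ℂ A :=
  ((ContinuousLinearMap.compL ℂ A (A →L[ℂ] A) (StrongDual ℂ A)).flip
    (ContinuousLinearMap.mul ℂ A)).comp (ContinuousLinearMap.compL ℂ A A ℂ)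

variable (A) in
/-- The map that takes `f` to `a ↦ (b ↦ f (b * a))`. -/
def dualMulRight : StrongDual ℂ A →L[ℂ] A →L[ℂ] StrongDual ℂ A :=
  ((ContinuousLinearMap.compL ℂ A (A →L[ℂ] A) (StrongDual ℂ A)).flip
    (ContinuousLinearMap.mul ℂ A).flip).comp (ContinuousLinearMap.compL ℂ A A ℂ)

/-- The first Arens product on `A**`: its value at `f` is `Φ (a ↦ Ψ (b ↦ f (a * b)))`. -/
def arensFirst (Φ Ψ : StrongDual ℂ (StrongDual ℂ A)) : StrongDual ℂ (StrongDual ℂ A) :=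
  Φ.comp ((ContinuousLinearMap.compL ℂ A (StrongDual ℂ A) ℂ Ψ).comp (dualMulLeft A))

/-- The second Arens product on `A**`: its value at `f` is `Ψ (a ↦ Φ (b ↦ f (b * a)))`. -/
def arensSecond (Φ Ψ : StrongDual ℂ (StrongDual ℂ A)) : StrongDual ℂ (StrongDual ℂ A) :=
  Ψ.comp ((ContinuousLinearMap.compL ℂ A (StrongDual ℂ A) ℂ Φ).comp (dualMulRight A))

/-- A mixed identity for `A**`: a right identity for the first Arens product and a left identity
for the second Arens product. -/
def IsMixedIdentity (E : StrongDual ℂ (StrongDual ℂ A)) : Prop :=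
  (∀ Φ, arensFirst Φ E = Φ) ∧ ∀ Φ, arensSecond E Φ = Φ

end Bidual

/-! ### The conditions of the theorem -/

section Conditions

variable {A : Type u} [NonUnitalNormedRing A]

/-- `A` is the closure of `xAx`. -/
def DenseInner (x : A) : Prop :=
  closure (Set.range fun a : A => x * a * x) = Set.univ

/-- `A` is the closure of `xA` and the closure of `Ax`. -/
def DenseLeftRight (x : A) : Prop :=
  closure (Set.range fun a : A => x * a) = Set.univ ∧
    closure (Set.range fun a : A => a * x) = Set.univ

/-- `s(x)` is a mixed identity for `A**`. -/
def FullSupport [NormedSpace ℂ A] [IsScalarTower ℂ A A] [SMulCommClass ℂ A A]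
    (LIM : BanachLimit) (x : A) : Prop :=
  IsMixedIdentity (support LIM x)

end Conditions

end

end RealPos

namespace RealPos

noncomputable section

/-! Everything rests on the resolvent elements x_s = (s + x)⁻¹x = 1 - s(s + x)⁻¹. Accretivity gives
‖(s + x)z‖ ≥ s‖z‖ (`IsAccretive.norm_le_mul_left`), so s(s + x)⁻¹ is a contraction. Hence x_s is
real positive, ‖x_s‖ ≤ 2, and x_s x - x = -s x_s tends to 0 with s. Principal roots are integrals of
x_s, and they inherit real positivity, commutation, a uniform bound and x^{1/n}x → x
(`norm_principalPow_le`, `tendsto_rootSeq_mul_self`).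

If xA and Ax are dense, the bounded roots therefore form an approximate identity, and their weak*
limit s(x) is a mixed identity. Conversely, a functional that kills xA (or Ax) kills every x^{1/n}a
(or a x^{1/n}), so full support makes it vanish and Hahn-Banach gives density
(`FullSupport.denseLeftRight`). A sequential bai, or a dense sequence when there is a bai, is
factored through a single real positive x = ∑ 2⁻ⁿfₙ by Cohen's method
(`exists_realPositiveIn_factorization`), which again makes xA and Ax dense.

On a Hilbert space the x_s are contractions, which yields the cai. If xA and Ax are dense, x₁ is
strictly real positive: a state with Re φ(x₁) = 0 equals 1 at the contraction 1 - x₁, so x₁ lies in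
its left kernel and φ vanishes on Ax (`isStrictlyRealPositive_resolventMul`).

For the converse, let ζₙ = (1 - x_{s_n})ξₙ with ‖ξₙ‖ ≤ 1 and s_n → 0. Then xζₙ → 0, so weak* limits
of the vector functionals at ζₙ vanish at x and hence, by strictness, on A. As a*a need not lie in
A, this does not give aζₙ → 0 at once. One averages members of the cai, each nearly fixing its
predecessor average: their values at ζₙ are almost orthogonal, so the average is small at ζₙ while a
is nearly unchanged by it (`exists_average`, `tendsto_norm_apply_zero`). The other side follows by
taking adjoints. -/

theorem commute_ringInverse_left {M : Type*} [MonoidWithZero M] {a b : M} (h : Commute a b)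
    (ha : IsUnit a) : Commute (Ring.inverse a) b := by
  obtain ⟨u, rfl⟩ := ha
  rw [Ring.inverse_unit]
  exact h.units_inv_left

/-! ### Accretive elements of a unital Banach algebra and their resolvents. -/

section Accretive

variable {B : Type v} [NormedRing B] [NormedAlgebra ℂ B]

/-- An element of a unital Banach algebra is accretive if its numerical range lies in the closed
right half plane. -/
def IsAccretive (b : B) : Prop :=
  ∀ φ : StrongDual ℂ B, IsState φ → 0 ≤ (φ b).re

theorem isState_of_norm_le [NormOneClass B] {φ : StrongDual ℂ B} (h : ‖φ‖ ≤ 1) (h1 : φ 1 = 1) :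
    IsState φ := by
  refine ⟨le_antisymm h ?_, h1⟩
  have := φ.le_opNorm 1
  simpa [h1] using this

theorem IsState.norm_apply_le {φ : StrongDual ℂ B} (h : IsState φ) (b : B) : ‖φ b‖ ≤ ‖b‖ := by
  simpa [h.1] using φ.le_opNorm b

theorem isAccretive_one_sub_of_norm_le {b : B} (h : ‖b‖ ≤ 1) : IsAccretive (1 - b) := by
  intro φ hφ
  have h1 := (Complex.re_le_norm (φ b)).trans ((hφ.norm_apply_le b).trans h)
  simp only [map_sub, hφ.2, Complex.sub_re, Complex.one_re]
  linarith

/-- States of the subalgebra extend by Hahn-Banach without increase of norm. -/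
theorem IsAccretive.of_mem_subalgebra [NormOneClass B] {S : Subalgebra ℂ B} {b : B} (hb : b ∈ S)
    (h : IsAccretive b) : IsAccretive (⟨b, hb⟩ : S) := by
  intro φ hφ
  obtain ⟨g, hg, hn⟩ := exists_extension_norm_eq (Subalgebra.toSubmodule S) φ
  have h1 : g 1 = 1 := by
    rw [← hφ.2]
    exact hg ⟨1, S.one_mem⟩
  have h2 := h g ⟨hn.trans hφ.1, h1⟩
  rwa [show g b = φ ⟨b, hb⟩ from hg ⟨b, hb⟩] at h2

variable [NormOneClass B] {b : B} {s : ℝ}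

/-- A norming functional g of z gives the state c ↦ g(cz)/‖z‖, on which accretivity is tested. This
is the Lumer-Phillips estimate. -/
theorem IsAccretive.norm_le_mul_left (h : IsAccretive b) (s : ℝ) (z : B) :
    s * ‖z‖ ≤ ‖(algebraMap ℂ B (s : ℂ) + b) * z‖ := by
  rcases eq_or_ne z 0 with rfl | hz
  · simp
  have hz' : 0 < ‖z‖ := norm_pos_iff.2 hz
  obtain ⟨g, hg, hgz⟩ := exists_dual_vector ℂ z hz'.ne'
  let φ : StrongDual ℂ B := ((‖z‖⁻¹ : ℝ) : ℂ) • g.comp ((ContinuousLinearMap.mul ℂ B).flip z)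
  have hφ (c : B) : φ c = ((‖z‖⁻¹ : ℝ) : ℂ) * g (c * z) := rfl
  have hst : IsState φ := by
    refine isState_of_norm_le (φ.opNorm_le_bound zero_le_one fun c => ?_) ?_
    · rw [hφ, norm_mul, Complex.norm_real, norm_inv, norm_norm, inv_mul_le_iff₀ hz', one_mul,
        mul_comm]
      refine (g.le_opNorm _).trans ?_
      rw [hg, one_mul]
      exact norm_mul_le _ _
    · rw [hφ, one_mul, hgz]
      push_cast
      exact inv_mul_cancel₀ (by exact_mod_cast hz'.ne')
  have h1 := h φ hst
  rw [hφ, Complex.re_ofReal_mul] at h1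
  have h2 : 0 ≤ (g (b * z)).re := by
    have := mul_nonneg hz'.le h1
    rwa [mul_inv_cancel_left₀ hz'.ne'] at this
  have h3 : (g ((algebraMap ℂ B (s : ℂ) + b) * z)).re = s * ‖z‖ + (g (b * z)).re := by
    rw [add_mul, ← Algebra.smul_def, map_add, map_smul, hgz, Complex.add_re, smul_eq_mul,
      Complex.re_ofReal_mul]
    rfl
  calc s * ‖z‖ ≤ (g ((algebraMap ℂ B (s : ℂ) + b) * z)).re := by rw [h3]; linarith
    _ ≤ ‖g ((algebraMap ℂ B (s : ℂ) + b) * z)‖ := Complex.re_le_norm _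
    _ ≤ ‖(algebraMap ℂ B (s : ℂ) + b) * z‖ := by simpa [hg] using g.le_opNorm _

theorem IsAccretive.norm_inv_le (h : IsAccretive b) (hs : 0 < s) {u : Bˣ}
    (hu : (u : B) = algebraMap ℂ B (s : ℂ) + b) : ‖(↑u⁻¹ : B)‖ ≤ s⁻¹ := by
  have := h.norm_le_mul_left s (↑u⁻¹ : B)
  rw [← hu, Units.mul_inv, norm_one] at this
  rwa [← one_div s, le_div_iff₀ hs, mul_comm]

variable [CompleteSpace B]

theorem IsAccretive.isUnit (h : IsAccretive b) (hs : 0 < s) :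
    IsUnit (algebraMap ℂ B (s : ℂ) + b) := by
  -- Since t > ‖b‖, t + b is invertible by a Neumann series. The a priori bound ‖(t + b)⁻¹‖ ≤ t⁻¹
  -- then allows a second perturbation of size |s - t| = ‖b‖ + 1 < t.
  set t : ℝ := s + ‖b‖ + 1
  have ht : 0 < t := by positivity
  have : Nontrivial B := NormOneClass.nontrivial
  let t' : Bˣ :=
    Units.map (algebraMap ℂ B).toMonoidHom (Units.mk0 (t : ℂ) (by exact_mod_cast ht.ne'))
  have ht' : (t' : B) = algebraMap ℂ B (t : ℂ) := rfl
  have ht'' : (↑t'⁻¹ : B) = algebraMap ℂ B (t : ℂ)⁻¹ := rfl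
  have h1 : ‖b‖ < ‖(↑t'⁻¹ : B)‖⁻¹ := by
    rw [ht'', norm_algebraMap', norm_inv, inv_inv, Complex.norm_real, Real.norm_of_nonneg ht.le]
    linarith
  let w : Bˣ := t'.add b h1
  have hw : (w : B) = algebraMap ℂ B (t : ℂ) + b := rfl
  have h2 : ‖algebraMap ℂ B ((s - t : ℝ) : ℂ)‖ < ‖(↑w⁻¹ : B)‖⁻¹ := by
    have h3 : t ≤ ‖(↑w⁻¹ : B)‖⁻¹ := by
      rw [le_inv_comm₀ ht (Units.norm_pos _)]
      exact h.norm_inv_le ht hw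
    refine lt_of_lt_of_le ?_ h3
    rw [norm_algebraMap', Complex.norm_real, Real.norm_eq_abs, abs_lt]
    have := norm_nonneg b
    constructor <;> simp only [t] <;> linarith
  refine ⟨w.add _ h2, ?_⟩
  rw [Units.val_add, hw]
  rw [Complex.ofReal_sub, map_sub]
  abel

theorem IsAccretive.norm_inverse_le (h : IsAccretive b) (hs : 0 < s) :
    ‖Ring.inverse (algebraMap ℂ B (s : ℂ) + b)‖ ≤ s⁻¹ := by
  obtain ⟨u, hu⟩ := h.isUnit hs
  rw [← hu, Ring.inverse_unit]
  exact h.norm_inv_le hs hu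

/-- A closed subalgebra is itself a Banach algebra in which b remains accretive, so the inverse
already exists there. -/
theorem IsAccretive.inverse_mem (h : IsAccretive b) (hs : 0 < s) {S : Subalgebra ℂ B}
    (hS : IsClosed (S : Set B)) (hb : b ∈ S) :
    Ring.inverse (algebraMap ℂ B (s : ℂ) + b) ∈ S := by
  have : CompleteSpace S := hS.completeSpace_coe
  have : NormOneClass S := ⟨norm_one (α := B)⟩
  obtain ⟨u, hu⟩ := (h.of_mem_subalgebra hb).isUnit hs
  have h1 : ((Units.map S.val.toMonoidHom u : Bˣ) : B) = algebraMap ℂ B (s : ℂ) + b := by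
    have := congrArg (Subtype.val) hu
    exact this
  rw [← h1, Ring.inverse_unit]
  exact (↑u⁻¹ : S).2

end Accretive

/-! ### The resolvent elements (s + x)⁻¹x of a nonunital algebra. -/

section Resolvent

variable {A : Type u} {B : Type v} [NonUnitalNormedRing A] [NormedSpace ℂ A]
  [NormedRing B] [NormedAlgebra ℂ B]

theorem norm_map_of_isometry {ι : A →ₙₐ[ℂ] B} (hι : Isometry ι) (a : A) : ‖ι a‖ = ‖a‖ :=
  (AddMonoidHomClass.isometry_iff_norm ι).1 hι a

theorem add_mem_realPositiveIn {ι : A →ₙₐ[ℂ] B} {x y : A} (hx : x ∈ realPositiveIn ι)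
    (hy : y ∈ realPositiveIn ι) : x + y ∈ realPositiveIn ι := by
  intro φ hφ
  simpa using add_nonneg (hx φ hφ) (hy φ hφ)

theorem smul_mem_realPositiveIn {ι : A →ₙₐ[ℂ] B} {x : A} (hx : x ∈ realPositiveIn ι) {t : ℝ}
    (ht : 0 ≤ t) : (t : ℂ) • x ∈ realPositiveIn ι := by
  intro φ hφ
  rw [map_smul, map_smul, smul_eq_mul, Complex.re_ofReal_mul]
  exact mul_nonneg ht (hx φ hφ)

theorem isClosed_realPositiveIn {ι : A →ₙₐ[ℂ] B} (hι : Isometry ι) :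
    IsClosed (realPositiveIn ι) := by
  simp only [realPositiveIn, Set.ofPred_forall]
  refine isClosed_iInter fun φ => isClosed_iInter fun _ => ?_
  exact isClosed_le continuous_const
    (Complex.continuous_re.comp (φ.continuous.comp hι.continuous))

variable [CompleteSpace A] [NormOneClass B] [CompleteSpace B]

theorem exists_map_eq_inverse_mul {ι : A →ₙₐ[ℂ] B} (hι : Isometry ι) {x : A}
    (hx : x ∈ realPositiveIn ι) {s : ℝ} (hs : 0 < s) :
    ∃ y, ι y = Ring.inverse (algebraMap ℂ B (s : ℂ) + ι x) * ι x := by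
  -- The elements of B that multiply the image of A into itself from the left form a closed unital
  -- subalgebra containing ι x, hence containing the inverse.
  let S : Subalgebra ℂ B :=
    { carrier := {c | ∀ a, c * ι a ∈ Set.range ι}
      mul_mem' := by
        rintro c d hc hd a
        obtain ⟨a', ha'⟩ := hd a
        rw [mul_assoc, ← ha']
        exact hc a'
      add_mem' := by
        rintro c d hc hd a
        obtain ⟨a', ha'⟩ := hd a
        obtain ⟨a'', ha''⟩ := hc a
        exact ⟨a'' + a', by rw [map_add, ha', ha'', add_mul]⟩
      algebraMap_mem' := fun r a => ⟨r • a, by rw [map_smul, Algebra.smul_def]⟩ }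
  have hS : IsClosed (S : Set B) := by
    have : (S : Set B) = ⋂ a, (fun c => c * ι a) ⁻¹' Set.range ι := by
      ext c
      simp [S]
    rw [this]
    exact isClosed_iInter fun a => hι.isClosedEmbedding.isClosed_range.preimage (by fun_prop)
  have h : IsAccretive (ι x) := hx
  exact h.inverse_mem hs hS (fun a => ⟨x * a, map_mul _ _ _⟩) x

variable [IsScalarTower ℂ A A] [SMulCommClass ℂ A A]

/-- The defining properties of `resolventMul x s` in a unital algebra containing `A`. -/
theorem resolventMul_spec {ι : A →ₙₐ[ℂ] B} (hι : Isometry ι) {x : A}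
    (hx : x ∈ realPositiveIn ι) {s : ℝ} (hs : 0 < s) :
    ι (resolventMul x s) = Ring.inverse (algebraMap ℂ B (s : ℂ) + ι x) * ι x := by
  obtain ⟨y, hy⟩ := exists_map_eq_inverse_mul hι hx hs
  have hu : IsUnit (algebraMap ℂ B (s : ℂ) + ι x) := IsAccretive.isUnit hx hs
  have hs' : (s : ℂ) ≠ 0 := by exact_mod_cast hs.ne'
  -- The two relations sy + xy = x = sy + yx suffice to exhibit s⁻¹(1 - y) as the inverse of s + x
  -- in the algebraic unitization, with no norm there.
  have h1 : (s : ℂ) • y + x * y = x := by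
    apply hι.injective
    rw [map_add, map_smul, map_mul, Algebra.smul_def, ← add_mul, hy,
      Ring.mul_inverse_cancel_left _ _ hu]
  have hcomm : Commute (Ring.inverse (algebraMap ℂ B (s : ℂ) + ι x)) (ι x) :=
    commute_ringInverse_left ((Algebra.commute_algebraMap_left _ _).add_left (Commute.refl _)) hu
  have h2 : (s : ℂ) • y + y * x = x := by
    apply hι.injective
    rw [map_add, map_smul, map_mul, Algebra.smul_def, Algebra.commutes, ← mul_add, hy, hcomm.eq,
      mul_assoc, Ring.inverse_mul_cancel _ hu, mul_one]
  have h1' : algebraMap ℂ (Unitization ℂ A) (s : ℂ) * y + x * y = x := by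
    rw [Unitization.algebraMap_eq_inl, Unitization.inl_mul_inr, ← Unitization.inr_mul,
      ← Unitization.inr_add, h1]
  have h2' : y * algebraMap ℂ (Unitization ℂ A) (s : ℂ) + y * x = x := by
    rw [← Algebra.commutes, Unitization.algebraMap_eq_inl, Unitization.inl_mul_inr,
      ← Unitization.inr_mul, ← Unitization.inr_add, h2]
  have h3 : algebraMap ℂ (Unitization ℂ A) (s : ℂ)⁻¹ * algebraMap ℂ (Unitization ℂ A) (s : ℂ)
      = 1 := by
    rw [← map_mul, inv_mul_cancel₀ hs', map_one]
  let U : (Unitization ℂ A)ˣ :=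
    { val := algebraMap ℂ (Unitization ℂ A) (s : ℂ) + (x : Unitization ℂ A)
      inv := algebraMap ℂ (Unitization ℂ A) (s : ℂ)⁻¹ * (1 - (y : Unitization ℂ A))
      val_inv := by
        rw [Algebra.commutes, ← mul_assoc, mul_sub, mul_one, add_mul, h1', add_sub_cancel_right,
          ← Algebra.commutes, h3]
      inv_val := by
        rw [mul_assoc, sub_mul, one_mul, mul_add, h2', add_sub_cancel_right, h3] }
  have hU : algebraMap ℂ (Unitization ℂ A) (s : ℂ) + (x : Unitization ℂ A) = U := rfl
  rw [← hy, resolventMul, hU, Ring.inverse_unit]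
  congr 1
  change (algebraMap ℂ (Unitization ℂ A) (s : ℂ)⁻¹ * (1 - (y : Unitization ℂ A)) * x).snd = y
  rw [mul_assoc, sub_mul, one_mul, sub_eq_iff_eq_add.2 h2'.symm, ← Algebra.commutes, ← mul_assoc,
    h3, one_mul, Unitization.snd_inr]

variable {ι : A →ₙₐ[ℂ] B}

theorem map_resolventMul (hι : Isometry ι) {x : A} (hx : x ∈ realPositiveIn ι) {s : ℝ}
    (hs : 0 < s) : ι (resolventMul x s) =
      1 - algebraMap ℂ B (s : ℂ) * Ring.inverse (algebraMap ℂ B (s : ℂ) + ι x) := by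
  have hu : IsUnit (algebraMap ℂ B (s : ℂ) + ι x) := IsAccretive.isUnit hx hs
  rw [resolventMul_spec hι hx hs, eq_sub_iff_add_eq, Algebra.commutes, ← mul_add, add_comm (ι x),
    Ring.inverse_mul_cancel _ hu]

theorem norm_smul_inverse_le {b : B} (h : IsAccretive b) {s : ℝ} (hs : 0 < s) :
    ‖algebraMap ℂ B (s : ℂ) * Ring.inverse (algebraMap ℂ B (s : ℂ) + b)‖ ≤ 1 := by
  refine (norm_mul_le _ _).trans ?_
  rw [norm_algebraMap', Complex.norm_real, Real.norm_of_nonneg hs.le]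
  calc s * _ ≤ s * s⁻¹ := by gcongr; exact h.norm_inverse_le hs
    _ = 1 := mul_inv_cancel₀ hs.ne'

theorem resolventMul_mem (hι : Isometry ι) {x : A} (hx : x ∈ realPositiveIn ι) {s : ℝ}
    (hs : 0 < s) : resolventMul x s ∈ realPositiveIn ι := by
  have := isAccretive_one_sub_of_norm_le (norm_smul_inverse_le hx hs)
  rw [← map_resolventMul hι hx hs] at this
  exact this

theorem norm_one_sub_map_resolventMul_le (hι : Isometry ι) {x : A} (hx : x ∈ realPositiveIn ι)
    {s : ℝ} (hs : 0 < s) : ‖1 - ι (resolventMul x s)‖ ≤ 1 := by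
  rw [map_resolventMul hι hx hs, sub_sub_cancel]
  exact norm_smul_inverse_le hx hs

theorem norm_resolventMul_le_two (hι : Isometry ι) {x : A} (hx : x ∈ realPositiveIn ι)
    {s : ℝ} (hs : 0 < s) : ‖resolventMul x s‖ ≤ 2 := by
  have h := norm_one_sub_map_resolventMul_le hι hx hs
  rw [← norm_map_of_isometry hι]
  calc ‖ι (resolventMul x s)‖ = ‖1 - (1 - ι (resolventMul x s))‖ := by rw [sub_sub_cancel]
    _ ≤ ‖(1 : B)‖ + ‖1 - ι (resolventMul x s)‖ := norm_sub_le _ _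
    _ ≤ 2 := by rw [norm_one]; linarith

theorem norm_resolventMul_le_inv_mul (hι : Isometry ι) {x : A} (hx : x ∈ realPositiveIn ι)
    {s : ℝ} (hs : 0 < s) : ‖resolventMul x s‖ ≤ s⁻¹ * ‖x‖ := by
  rw [← norm_map_of_isometry hι, resolventMul_spec hι hx hs, ← norm_map_of_isometry hι x]
  refine (norm_mul_le _ _).trans ?_
  gcongr
  exact IsAccretive.norm_inverse_le hx hs

theorem smul_resolventMul_add_mul (hι : Isometry ι) {x : A} (hx : x ∈ realPositiveIn ι) {s : ℝ}
    (hs : 0 < s) : (s : ℂ) • resolventMul x s + x * resolventMul x s = x := by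
  have hu : IsUnit (algebraMap ℂ B (s : ℂ) + ι x) := IsAccretive.isUnit hx hs
  apply hι.injective
  rw [map_add, map_smul, map_mul, Algebra.smul_def, ← add_mul, resolventMul_spec hι hx hs,
    Ring.mul_inverse_cancel_left _ _ hu]

theorem commute_resolventMul_resolventMul (hι : Isometry ι) {x : A} (hx : x ∈ realPositiveIn ι)
    {s t : ℝ} (hs : 0 < s) (ht : 0 < t) :
    Commute (resolventMul x s) (resolventMul x t) := by
  have h (r : ℝ) : Commute (algebraMap ℂ B (s : ℂ) + ι x) (algebraMap ℂ B (r : ℂ) + ι x) :=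
    (Algebra.commute_algebraMap_left _ _).add_left
      ((Algebra.commute_algebraMap_right _ _).add_right (Commute.refl _))
  have h' : Commute (ι (resolventMul x s)) (ι (resolventMul x t)) := by
    rw [map_resolventMul hι hx hs, map_resolventMul hι hx ht]
    refine (Commute.one_left _).sub_left ((Commute.one_right _).sub_right ?_)
    exact (Algebra.commute_algebraMap_left _ _).mul_left
      ((Algebra.commute_algebraMap_right _ _).mul_right (h t).ringInverse_ringInverse)
  apply hι.injective
  rw [map_mul, map_mul]
  exact h'

theorem commute_self_resolventMul (hι : Isometry ι) {x : A} (hx : x ∈ realPositiveIn ι)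
    {s : ℝ} (hs : 0 < s) : Commute x (resolventMul x s) := by
  have h' : Commute (ι x) (ι (resolventMul x s)) := by
    rw [map_resolventMul hι hx hs]
    refine (Commute.one_right _).sub_right ((Algebra.commute_algebraMap_right _ _).mul_right ?_)
    exact (commute_ringInverse_left ((Algebra.commute_algebraMap_left _ _).add_left
      (Commute.refl _)) (IsAccretive.isUnit hx hs)).symm
  apply hι.injective
  rw [map_mul, map_mul]
  exact h'

theorem smul_resolventMul_add_mul' (hι : Isometry ι) {x : A} (hx : x ∈ realPositiveIn ι) {s : ℝ}
    (hs : 0 < s) : (s : ℂ) • resolventMul x s + resolventMul x s * x = x := by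
  rw [← (commute_self_resolventMul hι hx hs).eq, smul_resolventMul_add_mul hι hx hs]

theorem continuousOn_resolventMul (hι : Isometry ι) {x : A} (hx : x ∈ realPositiveIn ι) :
    ContinuousOn (resolventMul x) (Set.Ioi 0) := by
  rw [hι.isEmbedding.continuousOn_iff]
  have h : ContinuousOn (fun s : ℝ => Ring.inverse (algebraMap ℂ B (s : ℂ) + ι x) * ι x)
      (Set.Ioi 0) := by
    refine ContinuousOn.mul (fun s hs => ContinuousAt.continuousWithinAt ?_) continuousOn_const
    obtain ⟨u, hu⟩ : IsUnit (algebraMap ℂ B (s : ℂ) + ι x) := IsAccretive.isUnit hx hs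
    have h1 : ContinuousAt Ring.inverse (algebraMap ℂ B (s : ℂ) + ι x) :=
      hu ▸ NormedRing.inverse_continuousAt u
    have h2 : Continuous fun s : ℝ => algebraMap ℂ B (s : ℂ) + ι x :=
      ((continuous_algebraMap ℂ B).comp Complex.continuous_ofReal).add continuous_const
    exact ContinuousAt.comp (f := fun s : ℝ => algebraMap ℂ B (s : ℂ) + ι x) h1 h2.continuousAt
  exact h.congr fun s hs => resolventMul_spec hι hx hs

end Resolvent

/-! ### Principal roots through Balakrishnan's integral. -/

section Roots

open MeasureTheory

theorem integrableOn_Ioc_rpow {r : ℝ} (hr : -1 < r) :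
    IntegrableOn (fun s : ℝ => s ^ r) (Set.Ioc 0 1) :=
  (intervalIntegrable_iff_integrableOn_Ioc_of_le zero_le_one).1
    (intervalIntegral.intervalIntegrable_rpow' hr)

theorem integral_Ioc_rpow {r : ℝ} (hr : 0 < r) : ∫ s in Set.Ioc (0 : ℝ) 1, s ^ (r - 1) = r⁻¹ := by
  rw [← intervalIntegral.integral_of_le zero_le_one, integral_rpow (Or.inl (by linarith))]
  simp [hr.ne']

theorem integral_Ioi_rpow {r : ℝ} (hr : r < 1) :
    ∫ s in Set.Ioi (1 : ℝ), s ^ (r - 2) = (1 - r)⁻¹ := by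
  rw [integral_Ioi_rpow_of_lt (by linarith) one_pos, Real.one_rpow, neg_div, ← div_neg, one_div]
  congr 1
  ring

/-- The constant `sin (r π) / π` in Balakrishnan's formula. -/
def powConst (r : ℝ) : ℝ := Real.sin (r * Real.pi) / Real.pi

theorem powConst_nonneg {r : ℝ} (h0 : 0 ≤ r) (h1 : r ≤ 1) : 0 ≤ powConst r :=
  div_nonneg (Real.sin_nonneg_of_nonneg_of_le_pi (by positivity)
    (by nlinarith [Real.pi_pos])) Real.pi_pos.le

theorem powConst_le {r : ℝ} (h0 : 0 ≤ r) : powConst r ≤ r := by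
  rw [powConst, div_le_iff₀ Real.pi_pos]
  exact Real.sin_le (by positivity)

/-- The limit is the derivative of r ↦ sin(rπ)/π at 0. -/
theorem tendsto_powConst_mul_inv :
    Tendsto (fun n : ℕ => powConst (1 / ((n : ℝ) + 1)) * (1 / ((n : ℝ) + 1))⁻¹) atTop (𝓝 1) := by
  have h1 : Tendsto (fun r : ℝ => r⁻¹ * powConst r) (𝓝[≠] 0) (𝓝 1) := by
    have h2 : HasDerivAt powConst 1 0 := by
      have h3 : HasDerivAt (fun r : ℝ => r * Real.pi) Real.pi 0 := by
        simpa using (hasDerivAt_id (0 : ℝ)).mul_const Real.pi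
      have := (h3.sin).div_const Real.pi
      simp only [zero_mul, Real.cos_zero, one_mul, div_self Real.pi_ne_zero] at this
      exact this
    have := h2.tendsto_slope_zero
    simpa [powConst] using this
  have h4 : Tendsto (fun n : ℕ => 1 / ((n : ℝ) + 1)) atTop (𝓝[≠] 0) := by
    refine tendsto_nhdsWithin_iff.2 ⟨tendsto_one_div_add_atTop_nhds_zero_nat,
      Eventually.of_forall fun n => ?_⟩
    have : (0 : ℝ) < 1 / ((n : ℝ) + 1) := by positivity
    exact this.ne'
  exact (h1.comp h4).congr fun n => mul_comm _ _

variable {A : Type u} {B : Type v} [NonUnitalNormedRing A] [NormedSpace ℂ A]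
  [NormedRing B] [NormedAlgebra ℂ B] [CompleteSpace A] [NormOneClass B] [CompleteSpace B]
  [IsScalarTower ℂ A A] [SMulCommClass ℂ A A] {ι : A →ₙₐ[ℂ] B}

theorem aestronglyMeasurable_rpow_smul_resolventMul (hι : Isometry ι) {x : A}
    (hx : x ∈ realPositiveIn ι) (r : ℝ) :
    AEStronglyMeasurable (fun s : ℝ => s ^ r • resolventMul x s)
      (volume.restrict (Set.Ioi 0)) := by
  refine ContinuousOn.aestronglyMeasurable ?_ measurableSet_Ioi
  have h : ContinuousOn (fun s : ℝ => s ^ r) (Set.Ioi 0) := fun s hs =>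
    (Real.continuousAt_rpow_const _ _ (Or.inl (ne_of_gt hs))).continuousWithinAt
  exact h.smul (continuousOn_resolventMul hι hx)

theorem norm_rpow_smul_resolventMul_le (hι : Isometry ι) {x : A} (hx : x ∈ realPositiveIn ι)
    (r : ℝ) {s : ℝ} (hs : 0 < s) : ‖s ^ (r - 1) • resolventMul x s‖ ≤ 2 * s ^ (r - 1) := by
  rw [norm_smul, Real.norm_of_nonneg (by positivity), mul_comm]
  gcongr
  exact norm_resolventMul_le_two hι hx hs

theorem norm_rpow_smul_resolventMul_le' (hι : Isometry ι) {x : A} (hx : x ∈ realPositiveIn ι)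
    (r : ℝ) {s : ℝ} (hs : 0 < s) : ‖s ^ (r - 1) • resolventMul x s‖ ≤ ‖x‖ * s ^ (r - 2) := by
  rw [norm_smul, Real.norm_of_nonneg (by positivity), show r - 2 = (r - 1) - 1 by ring,
    Real.rpow_sub_one hs.ne' (r - 1)]
  calc s ^ (r - 1) * ‖resolventMul x s‖ ≤ s ^ (r - 1) * (s⁻¹ * ‖x‖) := by
        gcongr
        exact norm_resolventMul_le_inv_mul hι hx hs
    _ = _ := by ring

theorem integrableOn_Ioc_resolventMul (hι : Isometry ι) {x : A} (hx : x ∈ realPositiveIn ι)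
    {r : ℝ} (h0 : 0 < r) :
    IntegrableOn (fun s : ℝ => s ^ (r - 1) • resolventMul x s) (Set.Ioc 0 1) := by
  refine Integrable.mono' ((integrableOn_Ioc_rpow (r := r - 1) (by linarith)).const_mul 2)
    ((aestronglyMeasurable_rpow_smul_resolventMul hι hx _).mono_measure
      (Measure.restrict_mono Set.Ioc_subset_Ioi_self le_rfl)) ?_
  exact (ae_restrict_mem measurableSet_Ioc).mono fun s hs =>
    norm_rpow_smul_resolventMul_le hι hx r hs.1

theorem integrableOn_Ioi_one_resolventMul (hι : Isometry ι) {x : A} (hx : x ∈ realPositiveIn ι)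
    {r : ℝ} (h1 : r < 1) :
    IntegrableOn (fun s : ℝ => s ^ (r - 1) • resolventMul x s) (Set.Ioi 1) := by
  refine Integrable.mono' ((integrableOn_Ioi_rpow_of_lt (a := r - 2) (by linarith)
    one_pos).const_mul ‖x‖) ((aestronglyMeasurable_rpow_smul_resolventMul hι hx _).mono_measure
      (Measure.restrict_mono (Set.Ioi_subset_Ioi zero_le_one) le_rfl)) ?_
  exact (ae_restrict_mem measurableSet_Ioi).mono fun s hs =>
    norm_rpow_smul_resolventMul_le' hι hx r (one_pos.trans hs)

theorem integrableOn_resolventMul (hι : Isometry ι) {x : A} (hx : x ∈ realPositiveIn ι)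
    {r : ℝ} (h0 : 0 < r) (h1 : r < 1) :
    IntegrableOn (fun s : ℝ => s ^ (r - 1) • resolventMul x s) (Set.Ioi 0) := by
  rw [← Set.Ioc_union_Ioi_eq_Ioi zero_le_one]
  exact (integrableOn_Ioc_resolventMul hι hx h0).union (integrableOn_Ioi_one_resolventMul hι hx h1)

/-- The cut at s = 1 separates the two bounds on the resolvent element: 2 near zero, ‖x‖/s near
infinity. -/
theorem principalPow_eq (hι : Isometry ι) {x : A} (hx : x ∈ realPositiveIn ι)
    {r : ℝ} (h0 : 0 < r) (h1 : r < 1) :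
    principalPow x r = powConst r • ((∫ s in Set.Ioc (0 : ℝ) 1, s ^ (r - 1) • resolventMul x s) +
      ∫ s in Set.Ioi (1 : ℝ), s ^ (r - 1) • resolventMul x s) := by
  rw [principalPow, if_neg h1.ne, ← Set.Ioc_union_Ioi_eq_Ioi zero_le_one,
    setIntegral_union (by simp) measurableSet_Ioi
      (integrableOn_Ioc_resolventMul hι hx h0) (integrableOn_Ioi_one_resolventMul hι hx h1)]
  rfl

/-- Only real linearity is asked of L, so that it can be the real part of a state. -/
theorem map_principalPow {E : Type*} [NormedAddCommGroup E] [NormedSpace ℝ E] [CompleteSpace E]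
    (hι : Isometry ι) {x : A} (hx : x ∈ realPositiveIn ι) {r : ℝ} (h0 : 0 < r) (h1 : r < 1)
    (L : A →L[ℝ] E) :
    L (principalPow x r) =
      powConst r • ∫ s in Set.Ioi (0 : ℝ), s ^ (r - 1) • L (resolventMul x s) := by
  rw [principalPow, if_neg h1.ne, map_smul,
    ← L.integral_comp_comm (integrableOn_resolventMul hι hx h0 h1)]
  simp only [map_smul]
  rfl

theorem principalPow_mem (hι : Isometry ι) {x : A} (hx : x ∈ realPositiveIn ι)
    {r : ℝ} (h0 : 0 < r) (h1 : r ≤ 1) : principalPow x r ∈ realPositiveIn ι := by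
  rcases h1.eq_or_lt with rfl | h1
  · rwa [principalPow, if_pos rfl]
  intro φ hφ
  let ιL : A →L[ℂ] B := ⟨(ι : A →ₗ[ℂ] B), hι.continuous⟩
  let L : A →L[ℝ] ℝ := Complex.reCLM.comp ((φ.comp ιL).restrictScalars ℝ)
  change 0 ≤ L (principalPow x r)
  rw [map_principalPow hι hx h0 h1]
  refine smul_nonneg (powConst_nonneg h0.le h1.le)
    (setIntegral_nonneg measurableSet_Ioi fun s hs => ?_)
  exact smul_nonneg (Real.rpow_nonneg (le_of_lt hs) _) (resolventMul_mem hι hx hs φ hφ)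

/-- Closed linear conditions pass from x and its resolvent elements to the roots. Both commutation
and annihilation by functionals are obtained this way. -/
theorem map_principalPow_eq_zero {E : Type*} [NormedAddCommGroup E] [NormedSpace ℂ E]
    [CompleteSpace E] (hι : Isometry ι) {x : A} (hx : x ∈ realPositiveIn ι) {r : ℝ} (h0 : 0 < r)
    (h1 : r ≤ 1) (L : A →L[ℂ] E) (hL : L x = 0) (hL' : ∀ s > 0, L (resolventMul x s) = 0) :
    L (principalPow x r) = 0 := by
  rcases h1.eq_or_lt with rfl | h1
  · rwa [principalPow, if_pos rfl]
  have := map_principalPow hι hx h0 h1 (L.restrictScalars ℝ)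
  rw [ContinuousLinearMap.coe_restrictScalars'] at this
  rw [this, setIntegral_congr_fun measurableSet_Ioi (g := fun _ => (0 : E)) fun s hs => by
    simp [hL' s hs]]
  simp

theorem commute_principalPow (hι : Isometry ι) {x : A} (hx : x ∈ realPositiveIn ι) {r : ℝ}
    (h0 : 0 < r) (h1 : r ≤ 1) {z : A} (hz : Commute z x)
    (hz' : ∀ s > 0, Commute z (resolventMul x s)) : Commute z (principalPow x r) := by
  have := map_principalPow_eq_zero hι hx h0 h1
    (ContinuousLinearMap.mul ℂ A z - (ContinuousLinearMap.mul ℂ A).flip z)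
    (sub_eq_zero.2 hz.eq) fun s hs => sub_eq_zero.2 (hz' s hs).eq
  exact sub_eq_zero.1 this

/-- The prefactor, at most r, cancels the growth 1/r of the integral of s^(r-1) near zero; r ≤ 1/2
keeps (1 - r)⁻¹ bounded. -/
theorem norm_principalPow_le (hι : Isometry ι) {x : A} (hx : x ∈ realPositiveIn ι)
    {r : ℝ} (h0 : 0 < r) (h1 : r ≤ 1 / 2) : ‖principalPow x r‖ ≤ 2 + ‖x‖ := by
  have h1' : r < 1 := by linarith
  rw [principalPow_eq hι hx h0 h1', norm_smul, Real.norm_of_nonneg (powConst_nonneg h0.le h1'.le)]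
  have i1 : ‖∫ s in Set.Ioc (0 : ℝ) 1, s ^ (r - 1) • resolventMul x s‖ ≤ 2 * r⁻¹ := by
    rw [← integral_Ioc_rpow h0, ← integral_const_mul]
    exact norm_integral_le_of_norm_le ((integrableOn_Ioc_rpow (by linarith)).const_mul 2)
      ((ae_restrict_mem measurableSet_Ioc).mono fun s hs =>
        norm_rpow_smul_resolventMul_le hι hx r hs.1)
  have i2 : ‖∫ s in Set.Ioi (1 : ℝ), s ^ (r - 1) • resolventMul x s‖ ≤ ‖x‖ * (1 - r)⁻¹ := by
    rw [← integral_Ioi_rpow h1', ← integral_const_mul]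
    exact norm_integral_le_of_norm_le
      ((integrableOn_Ioi_rpow_of_lt (by linarith) one_pos).const_mul ‖x‖)
      ((ae_restrict_mem measurableSet_Ioi).mono fun s hs =>
        norm_rpow_smul_resolventMul_le' hι hx r (one_pos.trans hs))
  have h2 : r * (1 - r)⁻¹ ≤ 1 := by
    rw [← div_eq_mul_inv, div_le_one (by linarith)]
    linarith
  calc powConst r * _ ≤ r * (2 * r⁻¹ + ‖x‖ * (1 - r)⁻¹) := by
        gcongr
        · exact powConst_le h0.le
        · exact (norm_add_le _ _).trans (add_le_add i1 i2)
    _ = 2 * (r * r⁻¹) + ‖x‖ * (r * (1 - r)⁻¹) := by ring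
    _ ≤ 2 * 1 + ‖x‖ * 1 := by
        gcongr
        exact (mul_inv_cancel₀ h0.ne').le
    _ = 2 + ‖x‖ := by ring

/-- On (0, 1] the identity x_s x - x = -s x_s removes the singularity of s^(r-1), so the integral
times x differs from r⁻¹x by a bounded amount. The tail is bounded as well, and the prefactor
contributes the r. -/
theorem norm_principalPow_mul_sub_le (hι : Isometry ι) {x : A} (hx : x ∈ realPositiveIn ι)
    {r : ℝ} (h0 : 0 < r) (h1 : r ≤ 1 / 2) :
    ‖principalPow x r * x - (powConst r * r⁻¹) • x‖ ≤ r * (2 + 2 * ‖x‖ * ‖x‖) := by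
  have h1' : r < 1 := by linarith
  have hI := integrableOn_Ioc_resolventMul hι hx h0
  have i1 : ‖(∫ s in Set.Ioc (0 : ℝ) 1, s ^ (r - 1) • resolventMul x s) * x - r⁻¹ • x‖ ≤ 2 := by
    have e1 : (∫ s in Set.Ioc (0 : ℝ) 1, s ^ (r - 1) • resolventMul x s) * x =
        ∫ s in Set.Ioc (0 : ℝ) 1, (s ^ (r - 1) • resolventMul x s) * x :=
      ((((ContinuousLinearMap.mul ℂ A).flip x).restrictScalars ℝ).integral_comp_comm hI).symm
    have hI' : IntegrableOn (fun s : ℝ => (s ^ (r - 1) • resolventMul x s) * x) (Set.Ioc 0 1) :=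
      (((ContinuousLinearMap.mul ℂ A).flip x).restrictScalars ℝ).integrable_comp hI
    rw [e1, ← integral_Ioc_rpow h0, ← integral_smul_const, ← integral_sub hI'
      ((integrableOn_Ioc_rpow (by linarith)).smul_const x)]
    have : ∀ s ∈ Set.Ioc (0 : ℝ) 1,
        ‖(s ^ (r - 1) • resolventMul x s) * x - s ^ (r - 1) • x‖ ≤ 2 := by
      intro s hs
      have e2 : resolventMul x s * x - x = -((s : ℂ) • resolventMul x s) := by
        rw [eq_neg_iff_add_eq_zero, sub_add_eq_add_sub, add_comm,
          smul_resolventMul_add_mul' hι hx hs.1, sub_self]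
      rw [smul_mul_assoc, ← smul_sub, e2, norm_smul, norm_neg, norm_smul, Complex.norm_real,
        Real.norm_of_nonneg hs.1.le, Real.norm_of_nonneg (Real.rpow_nonneg hs.1.le _),
        ← mul_assoc, ← Real.rpow_add_one hs.1.ne', sub_add_cancel]
      calc s ^ r * ‖resolventMul x s‖ ≤ 1 * 2 := by
            gcongr
            · exact Real.rpow_le_one hs.1.le hs.2 h0.le
            · exact norm_resolventMul_le_two hι hx hs.1
        _ = 2 := one_mul 2
    simpa using norm_setIntegral_le_of_norm_le_const (μ := volume) (by simp) this
  have i2 : ‖∫ s in Set.Ioi (1 : ℝ), s ^ (r - 1) • resolventMul x s‖ ≤ ‖x‖ * (1 - r)⁻¹ := by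
    rw [← integral_Ioi_rpow h1', ← integral_const_mul]
    exact norm_integral_le_of_norm_le
      ((integrableOn_Ioi_rpow_of_lt (by linarith) one_pos).const_mul ‖x‖)
      ((ae_restrict_mem measurableSet_Ioi).mono fun s hs =>
        norm_rpow_smul_resolventMul_le' hι hx r (one_pos.trans hs))
  have h2 : (1 - r)⁻¹ ≤ 2 := by
    rw [inv_le_comm₀ (by linarith) two_pos]
    linarith
  rw [principalPow_eq hι hx h0 h1', mul_smul, smul_mul_assoc, ← smul_sub, norm_smul,
    Real.norm_of_nonneg (powConst_nonneg h0.le h1'.le)]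
  gcongr
  · exact powConst_le h0.le
  · rw [add_mul, add_sub_right_comm]
    refine (norm_add_le _ _).trans (add_le_add i1 ((norm_mul_le _ _).trans ?_))
    gcongr
    exact i2.trans (by rw [mul_comm]; gcongr)

theorem rootSeq_exponent_pos (n : ℕ) : (0 : ℝ) < 1 / ((n : ℝ) + 1) := by positivity

theorem rootSeq_exponent_le_one (n : ℕ) : 1 / ((n : ℝ) + 1) ≤ 1 := by
  rw [div_le_one (by positivity)]
  linarith [Nat.cast_nonneg (α := ℝ) n]

theorem rootSeq_exponent_le_half {n : ℕ} (hn : n ≠ 0) : 1 / ((n : ℝ) + 1) ≤ 1 / 2 := by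
  have : (1 : ℝ) ≤ n := by exact_mod_cast Nat.one_le_iff_ne_zero.2 hn
  gcongr
  linarith

theorem rootSeq_mem (hι : Isometry ι) {x : A} (hx : x ∈ realPositiveIn ι) (n : ℕ) :
    rootSeq x n ∈ realPositiveIn ι :=
  principalPow_mem hι hx (rootSeq_exponent_pos n) (rootSeq_exponent_le_one n)

theorem norm_rootSeq_le (hι : Isometry ι) {x : A} (hx : x ∈ realPositiveIn ι) (n : ℕ) :
    ‖rootSeq x n‖ ≤ 2 + ‖x‖ := by
  rcases eq_or_ne n 0 with rfl | hn
  · simp [rootSeq, principalPow]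
  · exact norm_principalPow_le hι hx (rootSeq_exponent_pos n) (rootSeq_exponent_le_half hn)

theorem commute_self_rootSeq (hι : Isometry ι) {x : A} (hx : x ∈ realPositiveIn ι) (n : ℕ) :
    Commute x (rootSeq x n) :=
  commute_principalPow hι hx (rootSeq_exponent_pos n) (rootSeq_exponent_le_one n)
    (Commute.refl x) fun _ hs => commute_self_resolventMul hι hx hs

theorem commute_rootSeq (hι : Isometry ι) {x : A} (hx : x ∈ realPositiveIn ι) (m n : ℕ) :
    Commute (rootSeq x m) (rootSeq x n) :=
  commute_principalPow hι hx (rootSeq_exponent_pos n) (rootSeq_exponent_le_one n)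
    (commute_self_rootSeq hι hx m).symm fun _ hs =>
      (commute_principalPow hι hx (rootSeq_exponent_pos m) (rootSeq_exponent_le_one m)
        (commute_self_resolventMul hι hx hs).symm
        fun _ ht => commute_resolventMul_resolventMul hι hx hs ht).symm

theorem tendsto_rootSeq_mul_self (hι : Isometry ι) {x : A} (hx : x ∈ realPositiveIn ι) :
    Tendsto (fun n => rootSeq x n * x) atTop (𝓝 x) := by
  have h1 : Tendsto (fun n : ℕ => (powConst (1 / ((n : ℝ) + 1)) * (1 / ((n : ℝ) + 1))⁻¹) • x)
      atTop (𝓝 ((1 : ℝ) • x)) := tendsto_powConst_mul_inv.smul_const x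
  have h2 : Tendsto (fun n : ℕ => 1 / ((n : ℝ) + 1) * (2 + 2 * ‖x‖ * ‖x‖)) atTop (𝓝 0) := by
    simpa using tendsto_one_div_add_atTop_nhds_zero_nat.mul_const (2 + 2 * ‖x‖ * ‖x‖)
  have h3 : Tendsto (fun n : ℕ => rootSeq x n * x -
      (powConst (1 / ((n : ℝ) + 1)) * (1 / ((n : ℝ) + 1))⁻¹) • x) atTop (𝓝 0) := by
    refine squeeze_zero_norm' ((eventually_ne_atTop 0).mono fun n hn => ?_) h2
    exact norm_principalPow_mul_sub_le hι hx (rootSeq_exponent_pos n) (rootSeq_exponent_le_half hn)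
  simpa using h3.add h1

end Roots

/-! ### Weak* Banach limits and mixed identities of the second dual. -/

section Bidual

variable {A : Type u} [NonUnitalNormedRing A] [NormedSpace ℂ A]

theorem weakStarLim_apply_of_tendsto (LIM : BanachLimit) {a : ℕ → A} {C : ℝ}
    (ha : ∀ n, ‖a n‖ ≤ C) {f : StrongDual ℂ A} {z : ℂ}
    (h : Tendsto (fun n => f (a n)) atTop (𝓝 z)) : weakStarLim LIM a f = z := by
  have hex : ∃ C : ℝ, ∀ n, ‖a n‖ ≤ C := ⟨C, ha⟩
  rw [weakStarLim, dif_pos hex]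
  exact LIM.eq_of_tendsto _ _ h

variable [IsScalarTower ℂ A A] [SMulCommClass ℂ A A]

theorem isMixedIdentity_weakStarLim (LIM : BanachLimit) {S : Set A} {e : ℕ → A}
    (he : IsSeqBaiIn S e) : IsMixedIdentity (weakStarLim LIM e) := by
  obtain ⟨-, ⟨C, hC⟩, h⟩ := he
  refine ⟨fun Φ => ?_, fun Φ => ?_⟩
  · ext f
    refine congrArg Φ (ContinuousLinearMap.ext fun a => ?_)
    exact weakStarLim_apply_of_tendsto LIM hC ((f.continuous.tendsto a).comp (h a).2)
  · ext f
    refine congrArg Φ (ContinuousLinearMap.ext fun a => ?_)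
    exact weakStarLim_apply_of_tendsto LIM hC ((f.continuous.tendsto a).comp (h a).1)

/-- The identity property is tested on the canonical image of a in the second dual. -/
theorem IsMixedIdentity.apply_dualMulLeft {E : StrongDual ℂ (StrongDual ℂ A)}
    (hE : IsMixedIdentity E) (f : StrongDual ℂ A) (a : A) : E (dualMulLeft A f a) = f a :=
  congrArg (fun Φ : StrongDual ℂ (StrongDual ℂ A) => Φ f)
    (hE.1 (NormedSpace.inclusionInDoubleDual ℂ A a))

theorem IsMixedIdentity.apply_dualMulRight {E : StrongDual ℂ (StrongDual ℂ A)}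
    (hE : IsMixedIdentity E) (f : StrongDual ℂ A) (a : A) : E (dualMulRight A f a) = f a :=
  congrArg (fun Φ : StrongDual ℂ (StrongDual ℂ A) => Φ f)
    (hE.2 (NormedSpace.inclusionInDoubleDual ℂ A a))

end Bidual

/-- Hahn-Banach in the quotient by the closed range. -/
theorem closure_range_eq_univ_of_forall_dual {E F : Type*} [NormedAddCommGroup E] [NormedSpace ℂ E]
    [NormedAddCommGroup F] [NormedSpace ℂ F] (T : E →L[ℂ] F)
    (h : ∀ f : StrongDual ℂ F, (∀ a, f (T a) = 0) → f = 0) :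
    closure (Set.range T) = Set.univ := by
  by_contra hne
  obtain ⟨z, hz⟩ := (Set.ne_univ_iff_exists_notMem _).1 hne
  have : ∃ f : StrongDual ℂ F, (∀ a, f (T a) = 0) ∧ f z ≠ 0 := by
    let M : Submodule ℂ F := (LinearMap.range (T : E →ₗ[ℂ] F)).topologicalClosure
    have hM : IsClosed (M : Set F) := Submodule.isClosed_topologicalClosure _
    have hzM : M.mkQL z ≠ 0 := fun h0 => hz ((Submodule.Quotient.mk_eq_zero M).1 h0)
    obtain ⟨g, -, hg⟩ := exists_dual_vector ℂ (M.mkQL z) (norm_ne_zero_iff.2 hzM)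
    refine ⟨g.comp M.mkQL, fun a => ?_, ?_⟩
    · have : M.mkQL (T a) = 0 := (Submodule.Quotient.mk_eq_zero M).2
        (Submodule.le_topologicalClosure _ ⟨a, rfl⟩)
      rw [ContinuousLinearMap.comp_apply, this, map_zero]
    · rw [ContinuousLinearMap.comp_apply, hg]
      exact Complex.ofReal_ne_zero.2 (norm_ne_zero_iff.2 hzM)
  obtain ⟨f, hf, hfz⟩ := this
  exact hfz (by rw [h f hf]; rfl)

/-! ### Equivalence of the density conditions and full support. -/

section Equivalence

variable {A : Type u} [NonUnitalNormedRing A]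

theorem DenseInner.denseLeftRight {x : A} (h : DenseInner x) : DenseLeftRight x := by
  refine ⟨Set.eq_univ_of_univ_subset ?_, Set.eq_univ_of_univ_subset ?_⟩ <;> rw [← h]
  · refine closure_mono ?_
    rintro _ ⟨a, rfl⟩
    exact ⟨a * x, (mul_assoc _ _ _).symm⟩
  · refine closure_mono ?_
    rintro _ ⟨a, rfl⟩
    exact ⟨x * a, rfl⟩

theorem DenseLeftRight.denseInner {x : A} (h : DenseLeftRight x) : DenseInner x := by
  refine Set.eq_univ_of_univ_subset ?_
  rw [← h.1]
  refine closure_minimal ?_ isClosed_closure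
  rintro _ ⟨a, rfl⟩
  have ha : a ∈ closure (Set.range fun a : A => a * x) := h.2 ▸ Set.mem_univ a
  refine map_mem_closure (f := fun a => x * a) (by fun_prop) ha ?_
  rintro _ ⟨b, rfl⟩
  exact ⟨b, mul_assoc _ _ _⟩

theorem denseInner_iff_denseLeftRight {x : A} : DenseInner x ↔ DenseLeftRight x :=
  ⟨DenseInner.denseLeftRight, DenseLeftRight.denseInner⟩

/-- Convergence at x extends by associativity to xA and Ax, and by uniform boundedness to their
closures. -/
theorem isSeqBaiIn_of_denseLeftRight {S : Set A} {e : ℕ → A} {C : ℝ} (he : ∀ n, e n ∈ S)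
    (hC : ∀ n, ‖e n‖ ≤ C) {x : A} (hx : DenseLeftRight x)
    (h1 : Tendsto (fun n => e n * x) atTop (𝓝 x)) (h2 : Tendsto (fun n => x * e n) atTop (𝓝 x)) :
    IsSeqBaiIn S e := by
  have hC' (n : ℕ) : ‖e n‖ ≤ |C| := (hC n).trans (le_abs_self C)
  refine ⟨he, ⟨C, hC⟩, fun a => ⟨?_, ?_⟩⟩
  · rw [Metric.tendsto_atTop]
    intro ε hε
    have ha : a ∈ closure (Set.range fun a : A => x * a) := hx.1 ▸ Set.mem_univ a
    obtain ⟨_, ⟨b, rfl⟩, hb⟩ := Metric.mem_closure_iff.1 ha (ε / (2 * (|C| + 1))) (by positivity)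
    have h3 : Tendsto (fun n => e n * (x * b)) atTop (𝓝 (x * b)) := by
      simpa only [mul_assoc] using h1.mul_const b
    obtain ⟨N, hN⟩ := Metric.tendsto_atTop.1 h3 (ε / 2) (by positivity)
    refine ⟨N, fun n hn => ?_⟩
    have h4 := hN n hn
    rw [dist_eq_norm] at h4 hb ⊢
    calc ‖e n * a - a‖ = ‖e n * (a - x * b) + (e n * (x * b) - x * b) - (a - x * b)‖ := by
          congr 1; rw [mul_sub]; abel
      _ ≤ ‖e n‖ * ‖a - x * b‖ + ‖e n * (x * b) - x * b‖ + ‖a - x * b‖ :=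
          (norm_sub_le _ _).trans (add_le_add_left ((norm_add_le _ _).trans
            (add_le_add_left (norm_mul_le _ _) _)) _)
      _ ≤ |C| * ‖a - x * b‖ + ‖e n * (x * b) - x * b‖ + ‖a - x * b‖ := by
          gcongr; exact hC' n
      _ = (|C| + 1) * ‖a - x * b‖ + ‖e n * (x * b) - x * b‖ := by ring
      _ < (|C| + 1) * (ε / (2 * (|C| + 1))) + ε / 2 := by gcongr
      _ = ε := by field_simp; ring
  · rw [Metric.tendsto_atTop]
    intro ε hε
    have ha : a ∈ closure (Set.range fun a : A => a * x) := hx.2 ▸ Set.mem_univ a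
    obtain ⟨_, ⟨b, rfl⟩, hb⟩ := Metric.mem_closure_iff.1 ha (ε / (2 * (|C| + 1))) (by positivity)
    have h3 : Tendsto (fun n => b * x * e n) atTop (𝓝 (b * x)) := by
      simpa only [mul_assoc] using h2.const_mul b
    obtain ⟨N, hN⟩ := Metric.tendsto_atTop.1 h3 (ε / 2) (by positivity)
    refine ⟨N, fun n hn => ?_⟩
    have h4 := hN n hn
    rw [dist_eq_norm] at h4 hb ⊢
    calc ‖a * e n - a‖ = ‖(a - b * x) * e n + (b * x * e n - b * x) - (a - b * x)‖ := by
          congr 1; rw [sub_mul]; abel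
      _ ≤ ‖a - b * x‖ * ‖e n‖ + ‖b * x * e n - b * x‖ + ‖a - b * x‖ :=
          (norm_sub_le _ _).trans (add_le_add_left ((norm_add_le _ _).trans
            (add_le_add_left (norm_mul_le _ _) _)) _)
      _ ≤ ‖a - b * x‖ * |C| + ‖b * x * e n - b * x‖ + ‖a - b * x‖ := by
          gcongr; exact hC' n
      _ = (|C| + 1) * ‖a - b * x‖ + ‖b * x * e n - b * x‖ := by ring
      _ < (|C| + 1) * (ε / (2 * (|C| + 1))) + ε / 2 := by gcongr
      _ = ε := by field_simp; ring

variable {B : Type v} [NormedSpace ℂ A] [NormedRing B] [NormedAlgebra ℂ B] [CompleteSpace A]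
  [NormOneClass B] [CompleteSpace B] [IsScalarTower ℂ A A] [SMulCommClass ℂ A A]
  {ι : A →ₙₐ[ℂ] B}

theorem DenseLeftRight.isSeqBaiIn_rootSeq (hι : Isometry ι) {x : A} (hx : x ∈ realPositiveIn ι)
    (h : DenseLeftRight x) : IsSeqBaiIn (realPositiveIn ι) (rootSeq x) := by
  refine isSeqBaiIn_of_denseLeftRight (rootSeq_mem hι hx) (norm_rootSeq_le hι hx) h
    (tendsto_rootSeq_mul_self hι hx) ?_
  simpa only [(commute_self_rootSeq hι hx _).eq] using tendsto_rootSeq_mul_self hι hx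

theorem FullSupport.denseLeftRight (hι : Isometry ι) {x : A} (hx : x ∈ realPositiveIn ι)
    {LIM : BanachLimit} (h : FullSupport LIM x) : DenseLeftRight x := by
  constructor
  · refine closure_range_eq_univ_of_forall_dual (ContinuousLinearMap.mul ℂ A x) fun f hf => ?_
    ext a
    rw [← IsMixedIdentity.apply_dualMulRight h f a]
    refine weakStarLim_apply_of_tendsto LIM (norm_rootSeq_le hι hx) (tendsto_const_nhds.congr
      fun n => (map_principalPow_eq_zero hι hx (rootSeq_exponent_pos n)
        (rootSeq_exponent_le_one n) _ (hf a) fun s hs => ?_).symm)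
    -- Applying f to s x_s a + x x_s a = xa leaves s f(x_s a) = 0, because f kills xA.
    have h1 := congrArg (fun z => f (z * a)) (smul_resolventMul_add_mul hι hx hs)
    have h2 : f (x * (resolventMul x s * a)) = 0 := hf _
    have h3 : f (x * a) = 0 := hf a
    simp only [add_mul, map_add, smul_mul_assoc, map_smul, mul_assoc, h2, h3, add_zero,
      smul_eq_mul, mul_eq_zero, Complex.ofReal_eq_zero, hs.ne', false_or] at h1
    exact h1
  · refine closure_range_eq_univ_of_forall_dual ((ContinuousLinearMap.mul ℂ A).flip x)
      fun f hf => ?_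
    ext a
    rw [← IsMixedIdentity.apply_dualMulLeft h f a]
    refine weakStarLim_apply_of_tendsto LIM (norm_rootSeq_le hι hx) (tendsto_const_nhds.congr
      fun n => (map_principalPow_eq_zero hι hx (rootSeq_exponent_pos n)
        (rootSeq_exponent_le_one n) _ (hf a) fun s hs => ?_).symm)
    have h1 := congrArg (fun z => f (a * z)) (smul_resolventMul_add_mul' hι hx hs)
    have h2 : f (a * (resolventMul x s * x)) = 0 := by
      rw [← mul_assoc]
      exact hf _
    have h3 : f (a * x) = 0 := hf a
    simp only [mul_add, map_add, mul_smul_comm, map_smul, h2, h3, add_zero,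
      smul_eq_mul, mul_eq_zero, Complex.ofReal_eq_zero, hs.ne', false_or] at h1
    exact h1

theorem fullSupport_iff_denseLeftRight (hι : Isometry ι) {x : A} (hx : x ∈ realPositiveIn ι)
    (LIM : BanachLimit) : FullSupport LIM x ↔ DenseLeftRight x :=
  ⟨FullSupport.denseLeftRight hι hx, fun h =>
    isMixedIdentity_weakStarLim LIM (h.isSeqBaiIn_rootSeq hι hx)⟩

end Equivalence

/-! ### Cohen factorization by real positive elements. -/

section Factorization

theorem exists_tendsto_of_dist_le_geometric {E : Type*} [NormedAddCommGroup E]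
    [CompleteSpace E] {a : ℕ → E} {j : ℕ}
    (h : ∀ n, j ≤ n → ‖a (n + 1) - a n‖ ≤ (1 / 2) ^ n) : ∃ y, Tendsto a atTop (𝓝 y) := by
  have h1 : CauchySeq fun n => a (n + j) := by
    refine cauchySeq_of_le_geometric (1 / 2) 1 (by norm_num) fun n => ?_
    rw [dist_comm, dist_eq_norm, add_right_comm, one_mul]
    exact (h (n + j) (by omega)).trans (pow_le_pow_of_le_one (by norm_num) (by norm_num) (by omega))
  obtain ⟨y, hy⟩ := cauchySeq_tendsto_of_complete h1
  exact ⟨y, (tendsto_add_atTop_iff_nat j).1 hy⟩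

theorem IsSeqBaiIn.hasBaiIn {A : Type*} [NonUnitalNormedRing A] {S : Set A} {e : ℕ → A}
    (he : IsSeqBaiIn S e) : HasBaiIn S := by
  obtain ⟨hS, ⟨C, hC⟩, h⟩ := he
  exact ⟨Filter.map e atTop, ⟨fun a => (h a).2, fun a => (h a).1⟩,
    mem_map.2 (univ_mem' hS), C, eventually_map.2 (Eventually.of_forall hC)⟩

variable {A : Type u} {B : Type v} [NonUnitalNormedRing A] [NormedSpace ℂ A]
  [NormedRing B] [NormedAlgebra ℂ B] [CompleteSpace A] [NormOneClass B] [CompleteSpace B]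
  [IsScalarTower ℂ A A] [SMulCommClass ℂ A A] {ι : A →ₙₐ[ℂ] B}

/-- The element `(s + w)⁻¹ c` of `A`. -/
def leftDiv (s : ℝ) (w c : A) : A := (s : ℂ)⁻¹ • (c - resolventMul w s * c)

/-- The element `c (s + w)⁻¹` of `A`. -/
def rightDiv (s : ℝ) (w c : A) : A := (s : ℂ)⁻¹ • (c - c * resolventMul w s)

theorem map_leftDiv (hι : Isometry ι) {x : A} (hx : x ∈ realPositiveIn ι) {s : ℝ} (hs : 0 < s)
    (c : A) : ι (leftDiv s x c) = Ring.inverse (algebraMap ℂ B (s : ℂ) + ι x) * ι c := by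
  have hs' : (s : ℂ) ≠ 0 := by exact_mod_cast hs.ne'
  rw [leftDiv, map_smul, map_sub, map_mul, map_resolventMul hι hx hs, sub_mul, one_mul,
    sub_sub_cancel, mul_assoc, ← Algebra.smul_def, inv_smul_smul₀ hs']

theorem map_rightDiv (hι : Isometry ι) {x : A} (hx : x ∈ realPositiveIn ι) {s : ℝ} (hs : 0 < s)
    (c : A) : ι (rightDiv s x c) = ι c * Ring.inverse (algebraMap ℂ B (s : ℂ) + ι x) := by
  have hs' : (s : ℂ) ≠ 0 := by exact_mod_cast hs.ne'
  rw [rightDiv, map_smul, map_sub, map_mul, map_resolventMul hι hx hs, mul_sub, mul_one,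
    sub_sub_cancel, ← Algebra.smul_def, mul_smul_comm, inv_smul_smul₀ hs']

theorem smul_leftDiv_add_mul (hι : Isometry ι) {x : A} (hx : x ∈ realPositiveIn ι) {s : ℝ}
    (hs : 0 < s) (c : A) : (s : ℂ) • leftDiv s x c + x * leftDiv s x c = c := by
  apply hι.injective
  rw [map_add, map_smul, map_mul, Algebra.smul_def, ← add_mul, map_leftDiv hι hx hs,
    Ring.mul_inverse_cancel_left _ _ (IsAccretive.isUnit hx hs)]

theorem smul_rightDiv_add_mul (hι : Isometry ι) {x : A} (hx : x ∈ realPositiveIn ι) {s : ℝ}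
    (hs : 0 < s) (c : A) : (s : ℂ) • rightDiv s x c + rightDiv s x c * x = c := by
  apply hι.injective
  rw [map_add, map_smul, map_mul, Algebra.smul_def, Algebra.commutes, ← mul_add,
    map_rightDiv hι hx hs, Ring.inverse_mul_cancel_right _ _ (IsAccretive.isUnit hx hs)]

theorem norm_leftDiv_le (hι : Isometry ι) {x : A} (hx : x ∈ realPositiveIn ι) {s : ℝ}
    (hs : 0 < s) (c : A) : ‖leftDiv s x c‖ ≤ s⁻¹ * ‖c‖ := by
  rw [← norm_map_of_isometry hι, map_leftDiv hι hx hs, ← norm_map_of_isometry hι c]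
  refine (norm_mul_le _ _).trans ?_
  gcongr
  exact IsAccretive.norm_inverse_le hx hs

theorem norm_rightDiv_le (hι : Isometry ι) {x : A} (hx : x ∈ realPositiveIn ι) {s : ℝ}
    (hs : 0 < s) (c : A) : ‖rightDiv s x c‖ ≤ s⁻¹ * ‖c‖ := by
  rw [← norm_map_of_isometry hι, map_rightDiv hι hx hs, ← norm_map_of_isometry hι c, mul_comm]
  refine (norm_mul_le _ _).trans ?_
  gcongr
  exact IsAccretive.norm_inverse_le hx hs

/-- With d = (2s + w)⁻¹c one has (s + w + sf)d = c - s(d - fd). This is one step of Cohen's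
iteration: half of the scalar 2s is traded for sf, at a cost controlled by how nearly f fixes d. -/
theorem leftDiv_sub_leftDiv (hι : Isometry ι) {w f : A} (hw : w ∈ realPositiveIn ι)
    (hf : f ∈ realPositiveIn ι) {s : ℝ} (hs : 0 < s) (c : A) :
    leftDiv s (w + (s : ℂ) • f) c - leftDiv (2 * s) w c =
      leftDiv s (w + (s : ℂ) • f)
        ((s : ℂ) • (leftDiv (2 * s) w c - f * leftDiv (2 * s) w c)) := by
  have hw' := add_mem_realPositiveIn hw (smul_mem_realPositiveIn hf hs.le)
  have h2s : 0 < 2 * s := by positivity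
  set d := leftDiv (2 * s) w c with hd
  have h1 : (2 * s : ℂ) • d + w * d = c := by
    have := smul_leftDiv_add_mul hι hw h2s c
    rwa [Complex.ofReal_mul, Complex.ofReal_ofNat] at this
  have hu : IsUnit (algebraMap ℂ B (s : ℂ) + ι (w + (s : ℂ) • f)) := IsAccretive.isUnit hw' hs
  apply hι.injective
  rw [map_sub, map_leftDiv hι hw' hs, map_leftDiv hι hw' hs, sub_eq_iff_eq_add,
    ← hu.mul_right_inj, mul_add, Ring.mul_inverse_cancel_left _ _ hu,
    Ring.mul_inverse_cancel_left _ _ hu, ← h1]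
  simp only [map_add, map_smul, map_sub, map_mul, add_mul, smul_sub, ← Algebra.smul_def,
    smul_mul_assoc]
  rw [two_mul, add_smul]
  abel

theorem rightDiv_sub_rightDiv (hι : Isometry ι) {w f : A} (hw : w ∈ realPositiveIn ι)
    (hf : f ∈ realPositiveIn ι) {s : ℝ} (hs : 0 < s) (c : A) :
    rightDiv s (w + (s : ℂ) • f) c - rightDiv (2 * s) w c =
      rightDiv s (w + (s : ℂ) • f)
        ((s : ℂ) • (rightDiv (2 * s) w c - rightDiv (2 * s) w c * f)) := by
  have hw' := add_mem_realPositiveIn hw (smul_mem_realPositiveIn hf hs.le)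
  have h2s : 0 < 2 * s := by positivity
  set d := rightDiv (2 * s) w c with hd
  have h1 : (2 * s : ℂ) • d + d * w = c := by
    have := smul_rightDiv_add_mul hι hw h2s c
    rwa [Complex.ofReal_mul, Complex.ofReal_ofNat] at this
  have hu : IsUnit (algebraMap ℂ B (s : ℂ) + ι (w + (s : ℂ) • f)) := IsAccretive.isUnit hw' hs
  apply hι.injective
  rw [map_sub, map_rightDiv hι hw' hs, map_rightDiv hι hw' hs, sub_eq_iff_eq_add,
    ← hu.mul_left_inj, add_mul, Ring.inverse_mul_cancel_right _ _ hu,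
    Ring.inverse_mul_cancel_right _ _ hu, ← h1]
  simp only [map_add, map_smul, map_sub, map_mul, mul_add, smul_sub, ← Algebra.commutes (s : ℂ),
    ← Algebra.smul_def, mul_smul_comm]
  rw [two_mul, add_smul]
  abel

theorem norm_leftDiv_sub_leftDiv_le (hι : Isometry ι) {w f : A} (hw : w ∈ realPositiveIn ι)
    (hf : f ∈ realPositiveIn ι) {s : ℝ} (hs : 0 < s) (c : A) :
    ‖leftDiv s (w + (s : ℂ) • f) c - leftDiv (2 * s) w c‖ ≤
      ‖leftDiv (2 * s) w c - f * leftDiv (2 * s) w c‖ := by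
  have hw' := add_mem_realPositiveIn hw (smul_mem_realPositiveIn hf hs.le)
  rw [leftDiv_sub_leftDiv hι hw hf hs]
  refine (norm_leftDiv_le hι hw' hs _).trans ?_
  rw [norm_smul, Complex.norm_real, Real.norm_of_nonneg hs.le, inv_mul_cancel_left₀ hs.ne']

theorem norm_rightDiv_sub_rightDiv_le (hι : Isometry ι) {w f : A} (hw : w ∈ realPositiveIn ι)
    (hf : f ∈ realPositiveIn ι) {s : ℝ} (hs : 0 < s) (c : A) :
    ‖rightDiv s (w + (s : ℂ) • f) c - rightDiv (2 * s) w c‖ ≤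
      ‖rightDiv (2 * s) w c - rightDiv (2 * s) w c * f‖ := by
  have hw' := add_mem_realPositiveIn hw (smul_mem_realPositiveIn hf hs.le)
  rw [rightDiv_sub_rightDiv hι hw hf hs]
  refine (norm_rightDiv_le hι hw' hs _).trans ?_
  rw [norm_smul, Complex.norm_real, Real.norm_of_nonneg hs.le, inv_mul_cancel_left₀ (ne_of_gt hs)]

/-- A simultaneous Cohen factorization: if `A` has a bounded approximate identity of real positive
elements, every countable subset of `A` lies in `xA ∩ Ax` for some real positive `x`. -/
theorem exists_realPositiveIn_factorization (hι : Isometry ι) (h : HasBaiIn (realPositiveIn ι))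
    (c : ℕ → A) : ∃ x ∈ realPositiveIn ι, ∀ j, (∃ y, x * y = c j) ∧ ∃ y, y * x = c j := by
  obtain ⟨l, hl, hlS, C, hC⟩ := h
  have := hl.neBot
  -- The next f depends on the current partial sum w and treats only the finitely many indices j ≤ n
  -- at stage n.
  have key : ∀ (n : ℕ) (w : A), ∃ f ∈ realPositiveIn ι, ‖f‖ ≤ C ∧ ∀ j ∈ Finset.range (n + 1),
      ‖leftDiv ((1 / 2) ^ n) w (c j) - f * leftDiv ((1 / 2) ^ n) w (c j)‖ ≤ (1 / 2) ^ n ∧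
      ‖rightDiv ((1 / 2) ^ n) w (c j) - rightDiv ((1 / 2) ^ n) w (c j) * f‖ ≤ (1 / 2) ^ n := by
    intro n w
    have h1 : ∀ᶠ f in l, ∀ j ∈ Finset.range (n + 1),
      ‖leftDiv ((1 / 2) ^ n) w (c j) - f * leftDiv ((1 / 2) ^ n) w (c j)‖ ≤ (1 / 2) ^ n ∧
      ‖rightDiv ((1 / 2) ^ n) w (c j) - rightDiv ((1 / 2) ^ n) w (c j) * f‖ ≤ (1 / 2) ^ n := by
      rw [eventually_all_finset]
      intro j _
      have hp : (0 : ℝ) < (1 / 2) ^ n := by positivity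
      refine Eventually.and ?_ ?_
      · filter_upwards [Metric.tendsto_nhds.1
          (hl.tendsto_mul_right (leftDiv ((1 / 2) ^ n) w (c j))) _ hp] with f hf
        rw [dist_comm, dist_eq_norm] at hf
        exact hf.le
      · filter_upwards [Metric.tendsto_nhds.1
          (hl.tendsto_mul_left (rightDiv ((1 / 2) ^ n) w (c j))) _ hp] with f hf
        rw [dist_comm, dist_eq_norm] at hf
        exact hf.le
    obtain ⟨f, hf1, hf2, hf3⟩ := (h1.and (hC.and hlS)).exists
    exact ⟨f, hf3, hf2, hf1⟩
  choose F hFmem hFC hF using key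
  -- Partial sums of ∑ 2⁻ⁿfₙ. At stage n the scalar still to be used up is 2⁻ⁿ, which keeps 2⁻ⁿ + wₙ
  -- invertible.
  let w : ℕ → A := fun n => Nat.rec 0
    (fun n w => w + (((1 / 2 : ℝ) ^ (n + 1) : ℝ) : ℂ) • F n w) n
  have hw_succ (n : ℕ) : w (n + 1) = w n + (((1 / 2 : ℝ) ^ (n + 1) : ℝ) : ℂ) • F n (w n) := rfl
  have hpos (n : ℕ) : (0 : ℝ) < (1 / 2) ^ n := by positivity
  have hw (n : ℕ) : w n ∈ realPositiveIn ι := by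
    induction n with
    | zero => intro φ _; simp [w]
    | succ n ih =>
      rw [hw_succ]
      exact add_mem_realPositiveIn ih (smul_mem_realPositiveIn (hFmem _ _) (hpos _).le)
  have h2 (n : ℕ) : (2 : ℝ) * (1 / 2) ^ (n + 1) = (1 / 2) ^ n := by rw [pow_succ]; ring
  obtain ⟨x, hx⟩ : ∃ x, Tendsto w atTop (𝓝 x) := by
    refine cauchySeq_tendsto_of_complete (cauchySeq_of_le_geometric (1 / 2) C (by norm_num)
      fun n => ?_)
    rw [dist_comm, dist_eq_norm, hw_succ, add_sub_cancel_left, norm_smul, Complex.norm_real,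
      Real.norm_of_nonneg (hpos _).le, mul_comm]
    have hC0 := (norm_nonneg _).trans (hFC n (w n))
    exact mul_le_mul (hFC _ _) (pow_le_pow_of_le_one (by norm_num) (by norm_num) (by omega))
      (hpos _).le hC0
  have hs0 : Tendsto (fun n : ℕ => (((1 / 2 : ℝ) ^ n : ℝ) : ℂ)) atTop (𝓝 0) := by
    have := (Complex.continuous_ofReal.tendsto 0).comp
      (tendsto_pow_atTop_nhds_zero_of_lt_one (r := (1 / 2 : ℝ)) (by norm_num) (by norm_num))
    rw [Complex.ofReal_zero] at this
    exact this
  refine ⟨x, (isClosed_realPositiveIn hι).mem_of_tendsto hx (Eventually.of_forall hw),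
    fun j => ⟨?_, ?_⟩⟩
  · obtain ⟨y, hy⟩ : ∃ y, Tendsto (fun n => leftDiv ((1 / 2) ^ n) (w n) (c j)) atTop (𝓝 y) := by
      -- The element c j is under control only from stage j on.
      refine exists_tendsto_of_dist_le_geometric (j := j) fun n hn => ?_
      have := norm_leftDiv_sub_leftDiv_le hι (hw n) (hFmem n (w n)) (hpos (n + 1)) (c j)
      rw [h2, ← hw_succ] at this
      exact this.trans (hF n (w n) j (Finset.mem_range.2 (by omega))).1
    refine ⟨y, tendsto_nhds_unique (f := fun _ : ℕ => c j) (l := atTop) ?_ tendsto_const_nhds⟩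
    have h3 := (hs0.smul hy).add (hx.mul hy)
    rw [zero_smul, zero_add] at h3
    exact h3.congr fun n => smul_leftDiv_add_mul hι (hw n) (hpos n) (c j)
  · obtain ⟨y, hy⟩ : ∃ y, Tendsto (fun n => rightDiv ((1 / 2) ^ n) (w n) (c j)) atTop (𝓝 y) := by
      refine exists_tendsto_of_dist_le_geometric (j := j) fun n hn => ?_
      have := norm_rightDiv_sub_rightDiv_le hι (hw n) (hFmem n (w n)) (hpos (n + 1)) (c j)
      rw [h2, ← hw_succ] at this
      exact this.trans (hF n (w n) j (Finset.mem_range.2 (by omega))).2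
    refine ⟨y, tendsto_nhds_unique (f := fun _ : ℕ => c j) (l := atTop) ?_ tendsto_const_nhds⟩
    have h3 := (hs0.smul hy).add (hy.mul hx)
    rw [zero_smul, zero_add] at h3
    exact h3.congr fun n => smul_rightDiv_add_mul hι (hw n) (hpos n) (c j)

theorem exists_denseLeftRight_of_isSeqBaiIn (hι : Isometry ι) {e : ℕ → A}
    (he : IsSeqBaiIn (realPositiveIn ι) e) : ∃ x ∈ realPositiveIn ι, DenseLeftRight x := by
  obtain ⟨x, hx, h⟩ := exists_realPositiveIn_factorization hι he.hasBaiIn e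
  refine ⟨x, hx, Set.eq_univ_of_forall fun a => ?_, Set.eq_univ_of_forall fun a => ?_⟩
  · refine mem_closure_of_tendsto (he.2.2 a).1 (Eventually.of_forall fun n => ?_)
    obtain ⟨y, hy⟩ := (h n).1
    exact ⟨y * a, by rw [← hy, mul_assoc]⟩
  · refine mem_closure_of_tendsto (he.2.2 a).2 (Eventually.of_forall fun n => ?_)
    obtain ⟨y, hy⟩ := (h n).2
    exact ⟨a * y, by rw [← hy, ← mul_assoc]⟩

theorem exists_denseLeftRight_of_separable [TopologicalSpace.SeparableSpace A] (hι : Isometry ι)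
    (h : HasBaiIn (realPositiveIn ι)) : ∃ x ∈ realPositiveIn ι, DenseLeftRight x := by
  obtain ⟨x, hx, h⟩ := exists_realPositiveIn_factorization hι h (TopologicalSpace.denseSeq A)
  have hd := TopologicalSpace.denseRange_denseSeq A
  refine ⟨x, hx, (hd.mono ?_).closure_eq, (hd.mono ?_).closure_eq⟩
  · rintro _ ⟨n, rfl⟩
    exact (h n).1
  · rintro _ ⟨n, rfl⟩
    exact (h n).2

end Factorization

/-! ### Almost orthogonality and averaging in Hilbert space. -/

section HilbertSpace

open scoped InnerProductSpace ComplexConjugate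

/-- Vectors that attain the operator norm up to a factor 2 reduce norm convergence to sequences of
vectors. -/
theorem tendsto_mul_zero_of_forall_vectors {H : Type w} [NormedAddCommGroup H]
    [InnerProductSpace ℂ H] {a : H →L[ℂ] H} {S : ℕ → H →L[ℂ] H}
    (h : ∀ ξ : ℕ → H, (∀ n, ‖ξ n‖ ≤ 1) → Tendsto (fun n => ‖a (S n (ξ n))‖) atTop (𝓝 0)) :
    Tendsto (fun n => a * S n) atTop (𝓝 0) := by
  have key (n : ℕ) : ∃ ξ : H, ‖ξ‖ ≤ 1 ∧ ‖a * S n‖ ≤ 2 * ‖a (S n ξ)‖ := by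
    rcases eq_or_ne (a * S n) 0 with h0 | h0
    · exact ⟨0, by simp, by simp [h0]⟩
    · obtain ⟨ξ, h1, h2⟩ := (a * S n).exists_lt_apply_of_lt_opNorm
        (half_lt_self (norm_pos_iff.2 h0))
      refine ⟨ξ, h1.le, ?_⟩
      have h3 : ‖a * S n‖ / 2 < ‖a (S n ξ)‖ := h2
      linarith
  choose ξ hξ hξ' using key
  refine squeeze_zero_norm hξ' ?_
  simpa using (h ξ hξ).const_mul 2

variable {H : Type w} [NormedAddCommGroup H] [InnerProductSpace ℂ H] [CompleteSpace H]

/-- A contraction that almost fixes a vector has an adjoint that almost fixes it. -/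
theorem norm_adjoint_apply_sub_sq_le {f : H →L[ℂ] H} (hf : ‖f‖ ≤ 1) (v : H) :
    ‖ContinuousLinearMap.adjoint f v - v‖ ^ 2 ≤ 2 * ‖v‖ * ‖f v - v‖ := by
  have h1 : ‖ContinuousLinearMap.adjoint f v‖ ≤ ‖v‖ := by
    refine (ContinuousLinearMap.le_opNorm _ _).trans ?_
    rw [LinearIsometryEquiv.norm_map]
    exact mul_le_of_le_one_left (norm_nonneg _) hf
  have h2 : ‖ContinuousLinearMap.adjoint f v - v‖ ^ 2 =
      ‖ContinuousLinearMap.adjoint f v‖ ^ 2 - ‖v‖ ^ 2 - 2 * (⟪v, f v - v⟫_ℂ).re := by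
    rw [@norm_sub_sq ℂ, ContinuousLinearMap.adjoint_inner_left, inner_sub_right,
      RCLike.re_eq_complex_re, Complex.sub_re, ← RCLike.re_eq_complex_re,
      inner_self_eq_norm_sq (𝕜 := ℂ) v]
    ring
  have h3 : -(⟪v, f v - v⟫_ℂ).re ≤ ‖v‖ * ‖f v - v‖ :=
    (neg_le_abs _).trans ((Complex.abs_re_le_norm _).trans (norm_inner_le_norm _ _))
  have h4 : ‖ContinuousLinearMap.adjoint f v‖ ^ 2 ≤ ‖v‖ ^ 2 := by gcongr
  rw [h2]
  linarith

/-- The adjoint of f nearly fixes gζ because f does, so ⟪gζ, fζ⟫ is close to ⟪gζ, ζ⟫. The bound δ²/2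
absorbs the square root lost in passing to the adjoint. -/
theorem norm_inner_apply_apply_le {f g : H →L[ℂ] H} (hf : ‖f‖ ≤ 1) (hg : ‖g‖ ≤ 1) {δ : ℝ}
    (hδ : 0 ≤ δ) (hfg : ‖f * g - g‖ ≤ δ ^ 2 / 2) {ζ : H} (hζ : ‖ζ‖ ≤ 1) :
    ‖⟪g ζ, f ζ⟫_ℂ‖ ≤ ‖⟪ζ, g ζ⟫_ℂ‖ + δ := by
  have hgζ : ‖g ζ‖ ≤ 1 := (g.le_of_opNorm_le_of_le hg hζ).trans (by norm_num)
  have h1 : ‖f (g ζ) - g ζ‖ ≤ δ ^ 2 / 2 := by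
    have := (f * g - g).le_of_opNorm_le_of_le hfg hζ
    simpa using this
  have h2 : ‖ContinuousLinearMap.adjoint f (g ζ) - g ζ‖ ≤ δ := by
    refine (sq_le_sq₀ (norm_nonneg _) hδ).1 ((norm_adjoint_apply_sub_sq_le hf (g ζ)).trans ?_)
    calc 2 * ‖g ζ‖ * ‖f (g ζ) - g ζ‖ ≤ 2 * 1 * (δ ^ 2 / 2) := by gcongr
      _ = δ ^ 2 := by ring
  have h3 : ⟪g ζ, f ζ⟫_ℂ = ⟪g ζ, ζ⟫_ℂ + ⟪ContinuousLinearMap.adjoint f (g ζ) - g ζ, ζ⟫_ℂ := by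
    rw [inner_sub_left, ContinuousLinearMap.adjoint_inner_left]
    ring
  rw [h3, ← norm_inner_symm]
  refine (norm_add_le _ _).trans ?_
  gcongr
  refine (norm_inner_le_norm _ _).trans ?_
  calc _ ≤ δ * 1 := by gcongr
    _ = δ := mul_one δ

variable {𝒜 : Set (H →L[ℂ] H)} {a : H →L[ℂ] H} {ζ : ℕ → H} {l : Filter ℕ}

/-- Averaging almost orthogonal vectors: the mean of `N` members of a contractive approximate
identity, each far behind the previous one, is small on vectors at which `𝒜` tends to vanish. -/
theorem exists_average (hconv : Convex ℝ 𝒜) (hne : 𝒜.Nonempty)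
    (hai : ∀ g ∈ 𝒜, ∀ ε > 0, ∃ f ∈ 𝒜, ‖f‖ ≤ 1 ∧ ‖a * f - a‖ ≤ ε ∧ ‖f * g - g‖ ≤ ε)
    (hζ : ∀ n, ‖ζ n‖ ≤ 1) (hlim : ∀ g ∈ 𝒜, Tendsto (fun n => ⟪ζ n, g (ζ n)⟫_ℂ) l (𝓝 0))
    (N : ℕ) {ε : ℝ} (hε : 0 < ε) :
    ∃ g ∈ 𝒜, ‖g‖ ≤ 1 ∧ ‖a * g - a‖ ≤ ε ∧ ∀ᶠ n in l, ‖g (ζ n)‖ ^ 2 ≤ 1 / (N + 1) + ε := by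
  induction N with
  | zero =>
    obtain ⟨g, hg⟩ := hne
    obtain ⟨f, hf, hf1, hf2, -⟩ := hai g hg ε hε
    refine ⟨f, hf, hf1, hf2, Eventually.of_forall fun n => ?_⟩
    have h1 : ‖f (ζ n)‖ ≤ 1 := (f.le_of_opNorm_le_of_le hf1 (hζ n)).trans (by norm_num)
    have h2 : ‖f (ζ n)‖ ^ 2 ≤ 1 := pow_le_one₀ (norm_nonneg _) h1
    simp only [CharP.cast_eq_zero, zero_add, div_one]
    linarith
  | succ N ih =>
    obtain ⟨g, hg, hg1, hg2, hg3⟩ := ih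
    obtain ⟨f, hf, hf1, hf2, hf3⟩ := hai g hg (min ε ((ε / 2) ^ 2 / 2)) (by positivity)
    set M : ℝ := (N : ℝ) + 1 with hM
    have hM0 : 0 < M := by positivity
    have hM1 : 0 < M + 1 := by positivity
    -- These weights update the uniform mean of M = N + 1 terms to one of M + 1 terms; they satisfy
    -- s²/M + t² = t.
    set s : ℝ := M / (M + 1) with hs
    set t : ℝ := 1 / (M + 1) with ht
    have hs0 : 0 ≤ s := by positivity
    have ht0 : 0 ≤ t := by positivity
    have hst : s + t = 1 := by rw [hs, ht, ← add_div, div_self hM1.ne']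
    refine ⟨s • g + t • f, hconv hg hf hs0 ht0 hst, ?_, ?_, ?_⟩
    · exact mem_closedBall_zero_iff.1 ((convex_closedBall (0 : H →L[ℂ] H) 1)
        (mem_closedBall_zero_iff.2 hg1) (mem_closedBall_zero_iff.2 hf1) hs0 ht0 hst)
    · have e1 : a * (s • g + t • f) - a = s • (a * g - a) + t • (a * f - a) := by
        have e0 : s • a + t • a = a := by rw [← add_smul, hst, one_smul]
        rw [mul_add, mul_smul_comm, mul_smul_comm, smul_sub, smul_sub, sub_add_sub_comm, e0]
      rw [e1, ← mem_closedBall_zero_iff]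
      exact (convex_closedBall (0 : H →L[ℂ] H) ε) (mem_closedBall_zero_iff.2 hg2)
        (mem_closedBall_zero_iff.2 (hf2.trans (min_le_left _ _))) hs0 ht0 hst
    · have hε2 : 0 < ε / 2 := by positivity
      filter_upwards [hg3, Metric.tendsto_nhds.1 (hlim g hg) (ε / 2) hε2] with n h1 h2
      rw [dist_zero_right] at h2
      have h3 := norm_inner_apply_apply_le hf1 hg1 hε2.le (hf3.trans (min_le_right _ _)) (hζ n)
      have h4 : (⟪g (ζ n), f (ζ n)⟫_ℂ).re ≤ ε :=
        (Complex.re_le_norm _).trans (h3.trans (by linarith))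
      have h5 : ‖f (ζ n)‖ ^ 2 ≤ 1 := pow_le_one₀ (norm_nonneg _)
        ((f.le_of_opNorm_le_of_le hf1 (hζ n)).trans (by norm_num))
      have e2 : ‖(s • g + t • f) (ζ n)‖ ^ 2 = s ^ 2 * ‖g (ζ n)‖ ^ 2 +
          2 * (s * t * (⟪g (ζ n), f (ζ n)⟫_ℂ).re) + t ^ 2 * ‖f (ζ n)‖ ^ 2 := by
        have : (s • g + t • f) (ζ n) = (s : ℂ) • g (ζ n) + (t : ℂ) • f (ζ n) := rfl
        rw [this, @norm_add_sq ℂ, norm_smul, norm_smul, Complex.norm_real, Complex.norm_real,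
          Real.norm_of_nonneg hs0, Real.norm_of_nonneg ht0, inner_smul_left, inner_smul_right,
          Complex.conj_ofReal, RCLike.re_eq_complex_re, Complex.re_ofReal_mul,
          Complex.re_ofReal_mul]
        ring
      rw [e2]
      push_cast
      calc _ ≤ s ^ 2 * (1 / M + ε) + 2 * (s * t * ε) + t ^ 2 * 1 := by gcongr
        _ = (s ^ 2 / M + t ^ 2) + ε * (s ^ 2 + 2 * (s * t)) := by ring
        _ ≤ t + ε * 1 := by
          have e3 : s ^ 2 / M + t ^ 2 = t := by
            rw [hs, ht]
            field_simp
          have e4 : s ^ 2 + 2 * (s * t) ≤ 1 := by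
            have : (s + t) ^ 2 = 1 := by rw [hst, one_pow]
            nlinarith [sq_nonneg t]
          rw [e3]
          gcongr
        _ = _ := by rw [mul_one]

/-- Write aζ = a(gζ) - (ag - a)ζ with g an average: the first term is small because gζ is eventually
small, the second because g is nearly a right unit for a. -/
theorem tendsto_norm_apply_zero (hconv : Convex ℝ 𝒜) (hne : 𝒜.Nonempty)
    (hai : ∀ g ∈ 𝒜, ∀ ε > 0, ∃ f ∈ 𝒜, ‖f‖ ≤ 1 ∧ ‖a * f - a‖ ≤ ε ∧ ‖f * g - g‖ ≤ ε)
    (hζ : ∀ n, ‖ζ n‖ ≤ 1) (hlim : ∀ g ∈ 𝒜, Tendsto (fun n => ⟪ζ n, g (ζ n)⟫_ℂ) l (𝓝 0)) :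
    Tendsto (fun n => ‖a (ζ n)‖) l (𝓝 0) := by
  rw [Metric.tendsto_nhds]
  intro ε hε
  set δ : ℝ := ε / (2 * (‖a‖ + 1)) with hδ
  have hδ0 : 0 < δ := by positivity
  obtain ⟨N, hN⟩ := exists_nat_one_div_lt (show (0 : ℝ) < δ ^ 2 / 2 by positivity)
  obtain ⟨g, -, -, hg2, hg3⟩ := exists_average hconv hne hai hζ hlim N
    (ε := min (ε / 2) (δ ^ 2 / 2)) (by positivity)
  filter_upwards [hg3] with n hn
  rw [dist_zero_right, norm_norm]
  have h1 : ‖g (ζ n)‖ ≤ δ := by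
    refine (sq_le_sq₀ (norm_nonneg _) hδ0.le).1 ?_
    have := min_le_right (ε / 2) (δ ^ 2 / 2)
    linarith
  have h2 : ‖(a * g - a) (ζ n)‖ ≤ ε / 2 := by
    have := (a * g - a).le_of_opNorm_le_of_le (hg2.trans (min_le_left _ _)) (hζ n)
    simpa using this
  have h3 : a (ζ n) = a (g (ζ n)) - (a * g - a) (ζ n) := by simp
  have h4 : ‖a‖ * δ < ε / 2 := by
    rw [hδ, ← mul_div_assoc, div_lt_iff₀ (by positivity)]
    nlinarith [norm_nonneg a]
  rw [h3]
  calc _ ≤ ‖a (g (ζ n))‖ + ‖(a * g - a) (ζ n)‖ := norm_sub_le _ _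
    _ ≤ ‖a‖ * δ + ε / 2 := add_le_add (a.le_opNorm_of_le h1) h2
    _ < ε := by linarith

end HilbertSpace

/-! ### Strictly real positive elements of operator algebras. -/

section OperatorAlgebra

open scoped InnerProductSpace ComplexConjugate

/-- The approximate unit properties of a contractive approximate identity, at two elements. -/
theorem HasCai.exists_norm_sub_le {A : Type*} [NonUnitalNormedRing A] (hA : HasCai A)
    (a b : A) {ε : ℝ} (hε : 0 < ε) :
    ∃ f : A, ‖f‖ ≤ 1 ∧ ‖a * f - a‖ ≤ ε ∧ ‖f * b - b‖ ≤ ε := by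
  obtain ⟨l, hl, hl1⟩ := hA
  have := hl.neBot
  obtain ⟨f, h1, h2, h3⟩ := (hl1.and ((Metric.tendsto_nhds.1 (hl.tendsto_mul_left a) ε hε).and
    (Metric.tendsto_nhds.1 (hl.tendsto_mul_right b) ε hε))).exists
  rw [dist_eq_norm] at h2 h3
  exact ⟨f, h1, h2.le, h3.le⟩

theorem IsStrictlyRealPositive.mem_realPositiveIn {A : Type u} {B : Type v} [NonUnitalNormedRing A]
    [NormedSpace ℂ A] [NormedRing B] [NormedAlgebra ℂ B] {ι : A →ₙₐ[ℂ] B} {x : A}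
    (hx : IsStrictlyRealPositive ι x) :
    x ∈ realPositiveIn ι := by
  intro φ hφ
  by_cases h : ∃ a : A, φ (ι a) ≠ 0
  · exact (hx φ hφ h).le
  · push Not at h
    rw [h x, Complex.zero_re]

variable {B : Type v} [NormedRing B] [NormedAlgebra ℂ B] {H : Type w} [NormedAddCommGroup H]
  [InnerProductSpace ℂ H] {π : B →ₐ[ℂ] (H →L[ℂ] H)}

theorem norm_rep (hπ : Isometry π) (b : B) : ‖π b‖ = ‖b‖ :=
  (AddMonoidHomClass.isometry_iff_norm π).1 hπ b

/-- The functional `b ↦ ⟪η, π(b) η⟫`. -/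
def vectorFunctional (π : B →ₐ[ℂ] (H →L[ℂ] H)) (hπ : Isometry π) (η : H) : StrongDual ℂ B :=
  (innerSL ℂ η).comp ((ContinuousLinearMap.apply ℂ H η).comp
    (⟨π.toLinearMap, hπ.continuous⟩ : B →L[ℂ] (H →L[ℂ] H)))

theorem vectorFunctional_apply (hπ : Isometry π) (η : H) (b : B) :
    vectorFunctional π hπ η b = ⟪η, π b η⟫_ℂ := rfl

theorem norm_vectorFunctional_apply_le (hπ : Isometry π) (η : H) (b : B) :
    ‖vectorFunctional π hπ η b‖ ≤ ‖η‖ ^ 2 * ‖b‖ := by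
  rw [vectorFunctional_apply]
  calc _ ≤ ‖η‖ * ‖π b η‖ := norm_inner_le_norm _ _
    _ ≤ ‖η‖ * (‖π b‖ * ‖η‖) := by gcongr; exact (π b).le_opNorm η
    _ = ‖η‖ ^ 2 * ‖b‖ := by rw [norm_rep hπ]; ring

theorem vectorFunctional_one (hπ : Isometry π) (η : H) :
    vectorFunctional π hπ η 1 = ((‖η‖ ^ 2 : ℝ) : ℂ) := by
  rw [vectorFunctional_apply, map_one, one_apply_eq_self, inner_self_eq_norm_sq_to_K]
  push_cast
  rfl

/-- The vectors p = (ξ + Tξ)/2 and q = (ξ - Tξ)/2 satisfy ‖p‖² + ‖q‖² ≤ ‖ξ‖² by the parallelogram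
law; Cauchy-Schwarz then bounds ‖p‖ + ‖c‖‖q‖. -/
theorem norm_half_add_le (hπ : Isometry π) {T : B} (hT : ‖T‖ ≤ 1) (c : B) :
    ‖(1 / 2 : ℂ) • (1 + T) + c * ((1 / 2 : ℂ) • (1 - T))‖ ≤ √(1 + ‖c‖ ^ 2) := by
  rw [← norm_rep hπ]
  refine ContinuousLinearMap.opNorm_le_bound _ (Real.sqrt_nonneg _) fun ξ => ?_
  set p : H := (1 / 2 : ℂ) • (ξ + π T ξ) with hp
  set q : H := (1 / 2 : ℂ) • (ξ - π T ξ) with hq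
  have e1 : π ((1 / 2 : ℂ) • (1 + T) + c * ((1 / 2 : ℂ) • (1 - T))) ξ = p + π c q := by
    simp [hp, hq]
  have h1 : ‖p‖ ^ 2 + ‖q‖ ^ 2 ≤ ‖ξ‖ ^ 2 := by
    have h2 : ‖π T ξ‖ ≤ ‖ξ‖ := by
      refine ((π T).le_opNorm ξ).trans ?_
      rw [norm_rep hπ]
      exact mul_le_of_le_one_left (norm_nonneg _) hT
    have h3 := parallelogram_law_with_norm ℂ ξ (π T ξ)
    have h4 : ‖π T ξ‖ ^ 2 ≤ ‖ξ‖ ^ 2 := by gcongr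
    rw [hp, hq, norm_smul, norm_smul]
    have h5 : ‖(1 / 2 : ℂ)‖ = 1 / 2 := by norm_num
    rw [h5]
    nlinarith
  rw [e1]
  have h6 : ‖p + π c q‖ ≤ ‖p‖ + ‖c‖ * ‖q‖ := by
    refine (norm_add_le _ _).trans ?_
    gcongr
    rw [← norm_rep hπ c]
    exact (π c).le_opNorm q
  refine h6.trans ?_
  refine (sq_le_sq₀ (by positivity) (by positivity)).1 ?_
  rw [mul_pow, Real.sq_sqrt (by positivity)]
  calc (‖p‖ + ‖c‖ * ‖q‖) ^ 2 ≤ (1 + ‖c‖ ^ 2) * (‖p‖ ^ 2 + ‖q‖ ^ 2) := by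
        nlinarith [sq_nonneg (‖c‖ * ‖p‖ - ‖q‖)]
    _ ≤ _ := by gcongr

/-- If a state of an operator algebra takes the value one at a contraction `T`, then `1 - T` lies
in its left kernel. -/
theorem IsState.apply_mul_one_sub_eq_zero (hπ : Isometry π) {φ : StrongDual ℂ B} (hφ : IsState φ)
    {T : B} (hT : ‖T‖ ≤ 1) (hφT : φ T = 1) (c : B) : φ (c * (1 - T)) = 0 := by
  by_contra hz
  set z : ℂ := φ (c * (1 - T)) with hzdef
  set k : ℝ := ‖z‖ ^ 2 with hk
  have hk0 : 0 < k := by have := norm_pos_iff.2 hz; positivity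
  set K : ℝ := ‖conj z • c‖ ^ 2 with hK
  have hK0 : 0 ≤ K := by positivity
  -- The state takes the value 1 + εk/2 at an element of norm at most √(1 + ε²K): a first-order gain
  -- against a second-order bound, impossible for small ε if k > 0.
  have key (ε : ℝ) (hε : 0 < ε) : k ≤ ε * K := by
    have h1 := (hφ.norm_apply_le _).trans (norm_half_add_le hπ hT ((ε : ℂ) • conj z • c))
    have e1 : φ ((1 / 2 : ℂ) • (1 + T) + ((ε : ℂ) • conj z • c) * ((1 / 2 : ℂ) • (1 - T))) =
        ((1 + ε * k / 2 : ℝ) : ℂ) := by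
      rw [mul_smul_comm, smul_mul_assoc, smul_mul_assoc, map_add, map_smul, map_smul, map_smul,
        map_smul, map_add, hφ.2, hφT, ← hzdef, smul_eq_mul, smul_eq_mul, smul_eq_mul, smul_eq_mul,
        Complex.conj_mul']
      push_cast [hk]
      ring
    rw [e1, Complex.norm_real, Real.norm_of_nonneg (by positivity)] at h1
    have h2 := (Real.le_sqrt' (by positivity)).1 h1
    rw [norm_smul, mul_pow, Complex.norm_real, Real.norm_of_nonneg hε.le, ← hK] at h2
    have h3 : ε * k ≤ ε * (ε * K) := by nlinarith [sq_nonneg (ε * k)]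
    exact le_of_mul_le_mul_left h3 hε
  have h4 := key (k / (2 * (K + 1))) (by positivity)
  have h5 : k / (2 * (K + 1)) * K < k := by
    rw [div_mul_eq_mul_div, div_lt_iff₀ (by positivity)]
    nlinarith
  linarith

variable [NormOneClass B]

theorem isState_inv_smul {φ : StrongDual ℂ B} {r : ℝ} (hr : 0 < r) (h1 : φ 1 = (r : ℂ))
    (h : ∀ b, ‖φ b‖ ≤ r * ‖b‖) : IsState ((r : ℂ)⁻¹ • φ) := by
  refine isState_of_norm_le (ContinuousLinearMap.opNorm_le_bound _ zero_le_one fun b => ?_) ?_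
  · rw [smul_apply, norm_smul, norm_inv, Complex.norm_real,
      Real.norm_of_nonneg hr.le, inv_mul_le_iff₀ hr, one_mul]
    exact h b
  · rw [smul_apply, h1, smul_eq_mul,
      inv_mul_cancel₀ (by exact_mod_cast hr.ne')]

theorem IsAccretive.re_inner_nonneg (hπ : Isometry π) {b : B} (hb : IsAccretive b) (η : H) :
    0 ≤ (⟪η, π b η⟫_ℂ).re := by
  rcases eq_or_ne η 0 with rfl | hη
  · simp
  have hr : 0 < ‖η‖ ^ 2 := by have := norm_pos_iff.2 hη; positivity
  have h := hb _ (isState_inv_smul hr (vectorFunctional_one hπ η)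
    (norm_vectorFunctional_apply_le hπ η))
  rw [smul_apply, smul_eq_mul, ← Complex.ofReal_inv,
    Complex.re_ofReal_mul] at h
  have := mul_nonneg hr.le h
  rwa [mul_inv_cancel_left₀ hr.ne'] at this

variable {A : Type u} [NonUnitalNormedRing A] [NormedSpace ℂ A] {ι : A →ₙₐ[ℂ] B}

/-- Strict real positivity passes to limits of vector functionals. -/
theorem IsStrictlyRealPositive.tendsto_inner_zero (hπ : Isometry π) {x : A}
    (hx : IsStrictlyRealPositive ι x) {ζ : ℕ → H} (hζ : ∀ n, ‖ζ n‖ ≤ 1) (U : Ultrafilter ℕ)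
    (h : Tendsto (fun n => ⟪ζ n, π (ι x) (ζ n)⟫_ℂ) U (𝓝 0)) (a : A) :
    Tendsto (fun n => ⟪ζ n, π (ι a) (ζ n)⟫_ℂ) U (𝓝 0) := by
  let ψ : ℕ → WeakDual ℂ B := fun n => StrongDual.toWeakDual (vectorFunctional π hπ (ζ n))
  have hψ (n : ℕ) : ψ n ∈ WeakDual.toStrongDual ⁻¹' Metric.closedBall (0 : StrongDual ℂ B) 1 := by
    rw [Set.mem_preimage, mem_closedBall_zero_iff]
    refine ContinuousLinearMap.opNorm_le_bound _ zero_le_one fun b => ?_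
    refine (norm_vectorFunctional_apply_le hπ (ζ n) b).trans ?_
    gcongr
    exact pow_le_one₀ (norm_nonneg _) (hζ n)
  -- A weak* limit of the vector functionals along U has norm at most r = lim ‖ζ n‖², its value at
  -- 1. It is zero if r = 0, and otherwise r times a state, to which strictness applies.
  obtain ⟨φ', -, hφ'⟩ := (WeakDual.isCompact_closedBall (𝕜 := ℂ) (0 : StrongDual ℂ B)
    1).ultrafilter_le_nhds (U.map ψ) (le_principal_iff.2 (mem_map.2 (univ_mem' hψ)))
  let φ : StrongDual ℂ B := WeakDual.toStrongDual φ'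
  have hφ (b : B) : Tendsto (fun n => ⟪ζ n, π b (ζ n)⟫_ℂ) U (𝓝 (φ b)) :=
    ((WeakDual.eval_continuous b).tendsto φ').comp (show Tendsto ψ U (𝓝 φ') from hφ')
  set r : ℝ := (φ 1).re with hr
  have h1 : Tendsto (fun n => ((‖ζ n‖ ^ 2 : ℝ) : ℂ)) U (𝓝 (φ 1)) :=
    (hφ 1).congr fun n => vectorFunctional_one hπ (ζ n)
  have hr1 : Tendsto (fun n => ‖ζ n‖ ^ 2) U (𝓝 r) :=
    ((Complex.continuous_re.tendsto _).comp h1).congr fun n => Complex.ofReal_re _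
  have hφ1 : φ 1 = (r : ℂ) :=
    tendsto_nhds_unique h1 ((Complex.continuous_ofReal.tendsto r).comp hr1)
  have hbound (b : B) : ‖φ b‖ ≤ r * ‖b‖ :=
    le_of_tendsto_of_tendsto' (hφ b).norm (hr1.mul_const ‖b‖) fun n =>
      norm_vectorFunctional_apply_le hπ (ζ n) b
  have hr0 : 0 ≤ r := ge_of_tendsto' hr1 fun n => by positivity
  suffices hz : φ (ι a) = 0 by
    rw [← hz]
    exact hφ (ι a)
  rcases hr0.eq_or_lt with hr0 | hr0
  · have := hbound (ι a)
    rw [← hr0, zero_mul] at this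
    exact norm_le_zero_iff.1 this
  · by_contra hne
    have hr' : (r : ℂ)⁻¹ ≠ 0 := inv_ne_zero (by exact_mod_cast hr0.ne')
    have h2 := hx _ (isState_inv_smul hr0 hφ1 hbound) ⟨a, by
      rw [smul_apply, smul_eq_mul]
      exact mul_ne_zero hr' hne⟩
    rw [smul_apply, tendsto_nhds_unique (hφ (ι x)) h, smul_zero, Complex.zero_re] at h2
    exact lt_irrefl _ h2

variable [CompleteSpace A] [CompleteSpace B] [IsScalarTower ℂ A A] [SMulCommClass ℂ A A]

/-- For ξ = sη + xη, ‖ξ‖² = ‖sη‖² + 2s Re⟪η, xη⟫ + ‖xη‖² ≥ ‖xη‖². This improves the general bound 2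
and is what makes the approximate identity contractive. -/
theorem norm_resolventMul_le_one (hι : Isometry ι) (hπ : Isometry π) {x : A}
    (hx : x ∈ realPositiveIn ι) {s : ℝ} (hs : 0 < s) : ‖resolventMul x s‖ ≤ 1 := by
  have hu : IsUnit (algebraMap ℂ B (s : ℂ) + ι x) := IsAccretive.isUnit hx hs
  rw [← norm_map_of_isometry hι, ← norm_rep hπ]
  refine ContinuousLinearMap.opNorm_le_bound _ zero_le_one fun ξ => ?_
  rw [one_mul]
  set η : H := π (Ring.inverse (algebraMap ℂ B (s : ℂ) + ι x)) ξ with hη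
  have h1 : ξ = (s : ℂ) • η + π (ι x) η := by
    have h0 : π ((algebraMap ℂ B (s : ℂ) + ι x) *
        Ring.inverse (algebraMap ℂ B (s : ℂ) + ι x)) ξ = ξ := by
      rw [Ring.mul_inverse_cancel _ hu, map_one, one_apply_eq_self]
    rw [add_mul, ← Algebra.smul_def, map_add, map_smul, map_mul] at h0
    exact h0.symm
  have h2 : π (ι (resolventMul x s)) ξ = π (ι x) η := by
    rw [map_resolventMul hι hx hs, ← Algebra.smul_def, map_sub, map_smul, map_one]
    change ξ - (s : ℂ) • η = π (ι x) η
    rw [sub_eq_iff_eq_add', ← h1]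
  rw [h2]
  clear_value η
  refine (sq_le_sq₀ (norm_nonneg _) (norm_nonneg _)).1 ?_
  rw [h1, @norm_add_sq ℂ, inner_smul_left, Complex.conj_ofReal, RCLike.re_eq_complex_re,
    Complex.re_ofReal_mul]
  have h3 := mul_nonneg hs.le (IsAccretive.re_inner_nonneg hπ (b := ι x) hx η)
  nlinarith [sq_nonneg ‖(s : ℂ) • η‖]

theorem tendsto_resolventMul_mul_self (hι : Isometry ι) {x : A} (hx : x ∈ realPositiveIn ι) :
    Tendsto (fun n : ℕ => resolventMul x (1 / ((n : ℝ) + 1)) * x) atTop (𝓝 x) := by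
  rw [tendsto_iff_norm_sub_tendsto_zero]
  have h2 : Tendsto (fun n : ℕ => 1 / ((n : ℝ) + 1) * 2) atTop (𝓝 0) := by
    simpa using tendsto_one_div_add_atTop_nhds_zero_nat.mul_const (2 : ℝ)
  refine squeeze_zero (fun _ => norm_nonneg _) (fun n => ?_) h2
  have hs := rootSeq_exponent_pos n
  have h1 := smul_resolventMul_add_mul' hι hx hs
  rw [norm_sub_rev, ← eq_sub_iff_add_eq.2 h1, norm_smul, Complex.norm_real,
    Real.norm_of_nonneg hs.le]
  gcongr
  exact norm_resolventMul_le_two hι hx hs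

theorem exists_isSeqCaiIn (hι : Isometry ι) (hπ : Isometry π) {x : A} (hx : x ∈ realPositiveIn ι)
    (h : DenseLeftRight x) : ∃ e, IsSeqCaiIn (realPositiveIn ι) e := by
  have h1 := tendsto_resolventMul_mul_self hι hx
  have hpos := rootSeq_exponent_pos
  have hn (n : ℕ) := norm_resolventMul_le_one hι hπ hx (hpos n)
  have hb := isSeqBaiIn_of_denseLeftRight (fun n => resolventMul_mem hι hx (hpos n)) hn h h1
    (h1.congr fun n => (commute_self_resolventMul hι hx (hpos n)).eq.symm)
  exact ⟨_, hb.1, hn, hb.2.2⟩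

theorem isStrictlyRealPositive_resolventMul (hι : Isometry ι) (hπ : Isometry π) {x : A}
    (hx : x ∈ realPositiveIn ι) (h : DenseLeftRight x) :
    IsStrictlyRealPositive ι (resolventMul x 1) := by
  intro φ hφ ⟨a, ha⟩
  refine (resolventMul_mem hι hx one_pos φ hφ).lt_of_ne fun h0 => ha ?_
  have hT := norm_one_sub_map_resolventMul_le hι hx one_pos
  have hre : (φ (1 - ι (resolventMul x 1))).re = 1 := by
    rw [map_sub, hφ.2, Complex.sub_re, ← h0, sub_zero, Complex.one_re]
  -- A complex number of modulus at most 1 with real part 1 is 1.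
  have hφT : φ (1 - ι (resolventMul x 1)) = 1 := by
    have h1 := (hφ.norm_apply_le _).trans hT
    have h2 := Complex.sq_norm_sub_sq_re (φ (1 - ι (resolventMul x 1)))
    rw [hre] at h2
    have h3 : (φ (1 - ι (resolventMul x 1))).im = 0 := by
      have := pow_le_one₀ (n := 2) (norm_nonneg _) h1
      nlinarith
    exact Complex.ext hre h3
  have h4 (b : A) : φ (ι (b * x)) = 0 := by
    -- The left factor b + bx is chosen so that its product with x₁ = (1 + x)⁻¹x is bx.
    have h5 := hφ.apply_mul_one_sub_eq_zero hπ hT hφT (ι (b + b * x))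
    have h6 := smul_resolventMul_add_mul hι hx one_pos
    rw [Complex.ofReal_one, one_smul] at h6
    rw [sub_sub_cancel, ← map_mul, add_mul, mul_assoc, ← mul_add, h6] at h5
    exact h5
  have h7 : IsClosed {b : A | φ (ι b) = 0} :=
    isClosed_eq (φ.continuous.comp hι.continuous) continuous_const
  have h8 : closure (Set.range fun b : A => b * x) ⊆ {b : A | φ (ι b) = 0} := by
    refine closure_minimal ?_ h7
    rintro _ ⟨b, rfl⟩
    exact h4 b
  rw [h.2] at h8
  exact h8 (Set.mem_univ a)

variable [CompleteSpace H]

theorem tendsto_norm_mul_one_sub_resolventMul (hι : Isometry ι) {x : A}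
    (hx : x ∈ realPositiveIn ι) :
    Tendsto (fun n : ℕ => ‖ι x * (1 - ι (resolventMul x (1 / ((n : ℝ) + 1))))‖) atTop (𝓝 0) := by
  have h := (tendsto_resolventMul_mul_self hι hx).const_sub x
  rw [sub_self] at h
  refine (tendsto_zero_iff_norm_tendsto_zero.1 h).congr fun n => ?_
  rw [← norm_map_of_isometry hι, map_sub, mul_sub, mul_one, ← map_mul,
    (commute_self_resolventMul hι hx (rootSeq_exponent_pos n)).eq]

theorem tendsto_mul_resolventMul (hι : Isometry ι) (hπ : Isometry π) (hA : HasCai A)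
    {x : A} (hx : IsStrictlyRealPositive ι x) (a : A) :
    Tendsto (fun n : ℕ => a * resolventMul x (1 / ((n : ℝ) + 1))) atTop (𝓝 a) := by
  have hxr := hx.mem_realPositiveIn
  obtain ⟨T, hTdef⟩ : ∃ T : ℕ → B, ∀ n, T n = 1 - ι (resolventMul x (1 / ((n : ℝ) + 1))) :=
    ⟨_, fun _ => rfl⟩
  have hT (n : ℕ) : ‖π (T n)‖ ≤ 1 := by
    rw [norm_rep hπ, hTdef]
    exact norm_one_sub_map_resolventMul_le hι hxr (rootSeq_exponent_pos n)
  have hxT : Tendsto (fun n => ‖ι x * T n‖) atTop (𝓝 0) := by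
    simpa only [hTdef] using tendsto_norm_mul_one_sub_resolventMul hι hxr
  have main : Tendsto (fun n => π (ι a) * π (T n)) atTop (𝓝 0) := by
    refine tendsto_mul_zero_of_forall_vectors fun ξ hξ => ?_
    -- Along an ultrafilter weak* compactness provides a limit without passing to subsequences.
    rw [tendsto_iff_ultrafilter]
    intro U hU
    have hζ (n : ℕ) : ‖π (T n) (ξ n)‖ ≤ 1 := by
      simpa using (π (T n)).le_of_opNorm_le_of_le (hT n) (hξ n)
    have hx0 : Tendsto (fun n => ⟪π (T n) (ξ n), π (ι x) (π (T n) (ξ n))⟫_ℂ) U (𝓝 0) := by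
      refine squeeze_zero_norm (fun n => ?_) (hxT.mono_left hU)
      have h1 : ‖π (ι x) (π (T n) (ξ n))‖ ≤ ‖ι x * T n‖ := by
        have := (π (ι x * T n)).le_of_opNorm_le_of_le (norm_rep hπ _).le (hξ n)
        rwa [mul_one, map_mul] at this
      refine (norm_inner_le_norm _ _).trans ?_
      exact (mul_le_of_le_one_left (norm_nonneg _) (hζ n)).trans h1
    have h0 := hx.tendsto_inner_zero hπ hζ U hx0
    refine tendsto_norm_apply_zero (𝒜 := Set.range fun b : A => π (ι b)) ?_ ⟨_, 0, rfl⟩ ?_ hζ ?_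
    · rintro _ ⟨b, rfl⟩ _ ⟨c, rfl⟩ s t - - -
      exact ⟨(s : ℂ) • b + (t : ℂ) • c, by simp only [map_add, map_smul]; rfl⟩
    · rintro _ ⟨g, rfl⟩ ε hε
      obtain ⟨f, h1, h2, h3⟩ := hA.exists_norm_sub_le a g hε
      refine ⟨_, ⟨f, rfl⟩, ?_, ?_, ?_⟩
      · rwa [norm_rep hπ, norm_map_of_isometry hι]
      · rwa [← map_mul, ← map_mul, ← map_sub, ← map_sub, norm_rep hπ, norm_map_of_isometry hι]
      · rwa [← map_mul, ← map_mul, ← map_sub, ← map_sub, norm_rep hπ, norm_map_of_isometry hι]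
    · rintro _ ⟨b, rfl⟩
      exact h0 b
  rw [tendsto_iff_norm_sub_tendsto_zero]
  refine (tendsto_zero_iff_norm_tendsto_zero.1 main).congr fun n => ?_
  rw [← map_mul, norm_rep hπ, hTdef, norm_sub_rev, ← norm_map_of_isometry hι, map_sub, map_mul,
    mul_sub, mul_one]

/-- The right-sided argument applied to adjoints: T commutes with x, so x* is small on the vectors
T*ξ, and the quadratic forms of x and x* are conjugate. -/
theorem tendsto_resolventMul_mul (hι : Isometry ι) (hπ : Isometry π) (hA : HasCai A)
    {x : A} (hx : IsStrictlyRealPositive ι x) (a : A) :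
    Tendsto (fun n : ℕ => resolventMul x (1 / ((n : ℝ) + 1)) * a) atTop (𝓝 a) := by
  have hxr := hx.mem_realPositiveIn
  obtain ⟨T, hTdef⟩ : ∃ T : ℕ → B, ∀ n, T n = 1 - ι (resolventMul x (1 / ((n : ℝ) + 1))) :=
    ⟨_, fun _ => rfl⟩
  have hT (n : ℕ) : ‖star (π (T n))‖ ≤ 1 := by
    rw [norm_star, norm_rep hπ, hTdef]
    exact norm_one_sub_map_resolventMul_le hι hxr (rootSeq_exponent_pos n)
  have hcomm (n : ℕ) : T n * ι x = ι x * T n := by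
    rw [hTdef, sub_mul, mul_sub, one_mul, mul_one, ← map_mul, ← map_mul,
      (commute_self_resolventMul hι hxr (rootSeq_exponent_pos n)).eq]
  have hxT : Tendsto (fun n => ‖ι x * T n‖) atTop (𝓝 0) := by
    simpa only [hTdef] using tendsto_norm_mul_one_sub_resolventMul hι hxr
  have main : Tendsto (fun n => star (π (ι a)) * star (π (T n))) atTop (𝓝 0) := by
    refine tendsto_mul_zero_of_forall_vectors fun ξ hξ => ?_
    rw [tendsto_iff_ultrafilter]
    intro U hU
    have hζ (n : ℕ) : ‖star (π (T n)) (ξ n)‖ ≤ 1 := by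
      simpa using (star (π (T n))).le_of_opNorm_le_of_le (hT n) (hξ n)
    have hx0 : Tendsto (fun n => ⟪star (π (T n)) (ξ n), π (ι x) (star (π (T n)) (ξ n))⟫_ℂ) U
        (𝓝 0) := by
      refine squeeze_zero_norm (fun n => ?_) (hxT.mono_left hU)
      have h1 : ‖star (π (ι x)) (star (π (T n)) (ξ n))‖ ≤ ‖ι x * T n‖ := by
        have := (star (π (T n * ι x))).le_of_opNorm_le_of_le
          ((norm_star _).trans (norm_rep hπ _)).le (hξ n)
        rwa [mul_one, map_mul, star_mul, hcomm] at this
      rw [← ContinuousLinearMap.adjoint_inner_left, ← ContinuousLinearMap.star_eq_adjoint]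
      refine (norm_inner_le_norm _ _).trans ?_
      exact (mul_le_of_le_one_right (norm_nonneg _) (hζ n)).trans h1
    have h0 := hx.tendsto_inner_zero hπ hζ U hx0
    refine tendsto_norm_apply_zero (𝒜 := Set.range fun b : A => star (π (ι b))) ?_ ⟨_, 0, rfl⟩ ?_
      hζ ?_
    · rintro _ ⟨b, rfl⟩ _ ⟨c, rfl⟩ s t - - -
      refine ⟨(s : ℂ) • b + (t : ℂ) • c, ?_⟩
      simp only [map_add, map_smul, star_add, star_smul, RCLike.star_def, Complex.conj_ofReal]
      rfl
    · rintro _ ⟨g, rfl⟩ ε hε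
      obtain ⟨f, h1, h2, h3⟩ := hA.exists_norm_sub_le g a hε
      refine ⟨_, ⟨f, rfl⟩, ?_, ?_, ?_⟩
      · rwa [norm_star, norm_rep hπ, norm_map_of_isometry hι]
      · rwa [← star_mul, ← star_sub, norm_star, ← map_mul, ← map_mul, ← map_sub, ← map_sub,
          norm_rep hπ, norm_map_of_isometry hι]
      · rwa [← star_mul, ← star_sub, norm_star, ← map_mul, ← map_mul, ← map_sub, ← map_sub,
          norm_rep hπ, norm_map_of_isometry hι]
    · rintro _ ⟨b, rfl⟩
      have h1 := (Complex.continuous_conj.tendsto _).comp (h0 b)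
      rw [map_zero] at h1
      refine h1.congr fun n => ?_
      rw [Function.comp_apply, inner_conj_symm]
      exact (ContinuousLinearMap.adjoint_inner_right (π (ι b)) _ _).symm
  rw [tendsto_iff_norm_sub_tendsto_zero]
  refine (tendsto_zero_iff_norm_tendsto_zero.1 main).congr fun n => ?_
  rw [← star_mul, norm_star, ← map_mul, norm_rep hπ, hTdef, norm_sub_rev,
    ← norm_map_of_isometry hι, map_sub, map_mul, sub_mul, one_mul]

theorem IsStrictlyRealPositive.denseLeftRight (hι : Isometry ι) (hπ : Isometry π) (hA : HasCai A)
    {x : A} (hx : IsStrictlyRealPositive ι x) : DenseLeftRight x := by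
  have hxr := hx.mem_realPositiveIn
  have hpos := rootSeq_exponent_pos
  have hs (n : ℕ) : ((1 / ((n : ℝ) + 1) : ℝ) : ℂ) ≠ 0 := Complex.ofReal_ne_zero.2 (hpos n).ne'
  refine ⟨Set.eq_univ_of_forall fun a => ?_, Set.eq_univ_of_forall fun a => ?_⟩
  · refine mem_closure_of_tendsto (tendsto_resolventMul_mul hι hπ hA hx a)
      (Eventually.of_forall fun n => ?_)
    -- From x - x x_s = s x_s it follows that x_s a = x · s⁻¹(a - x_s a), which lies in xA.
    refine ⟨((1 / ((n : ℝ) + 1) : ℝ) : ℂ)⁻¹ • (a - resolventMul x (1 / ((n : ℝ) + 1)) * a), ?_⟩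
    have h1 := smul_resolventMul_add_mul hι hxr (hpos n)
    change x * _ = _
    rw [mul_smul_comm, mul_sub, ← mul_assoc, ← sub_mul, ← eq_sub_iff_add_eq.2 h1, smul_mul_assoc,
      inv_smul_smul₀ (hs n)]
  · refine mem_closure_of_tendsto (tendsto_mul_resolventMul hι hπ hA hx a)
      (Eventually.of_forall fun n => ?_)
    refine ⟨((1 / ((n : ℝ) + 1) : ℝ) : ℂ)⁻¹ • (a - a * resolventMul x (1 / ((n : ℝ) + 1))), ?_⟩
    have h1 := smul_resolventMul_add_mul' hι hxr (hpos n)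
    change _ * x = _
    rw [smul_mul_assoc, sub_mul, mul_assoc, ← mul_sub, ← eq_sub_iff_add_eq.2 h1, mul_smul_comm,
      inv_smul_smul₀ (hs n)]

end OperatorAlgebra

end

end RealPos

/-! ### Assembly of the equivalences, all routed through density of xA and Ax. -/

open RealPos in
theorem corollary6 {A : Type u} [NonUnitalNormedRing A] [NormedSpace ℂ A]
    [IsScalarTower ℂ A A] [SMulCommClass ℂ A A] [CompleteSpace A] (LIM : BanachLimit) :
    List.TFAE [
      ∃ x ∈ realPositive A, DenseInner x,
      ∃ x ∈ realPositive A, DenseLeftRight x,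
      ∃ x ∈ realPositive A, FullSupport LIM x] ∧
    ∀ (B : Type u) [NormedRing B] [NormedAlgebra ℂ B] [NormOneClass B] [CompleteSpace B]
      (ι : A →ₙₐ[ℂ] B), Isometry ι →
      List.TFAE [
        ∃ x ∈ realPositiveIn ι, DenseInner x,
        ∃ x ∈ realPositiveIn ι, DenseLeftRight x,
        ∃ x ∈ realPositiveIn ι, FullSupport LIM x,
        ∃ e, IsSeqBaiIn (realPositiveIn ι) e] ∧
      (∀ x ∈ realPositiveIn ι, DenseInner x ∨ DenseLeftRight x ∨ FullSupport LIM x →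
        IsSeqBaiIn (realPositiveIn ι) (rootSeq x) ∧
          ∀ m n, Commute (rootSeq x m) (rootSeq x n)) ∧
      (TopologicalSpace.SeparableSpace A → HasBaiIn (realPositiveIn ι) →
        (∃ e, IsSeqBaiIn (realPositiveIn ι) e) ∧
        (∃ x ∈ realPositiveIn ι, DenseInner x) ∧
        (∃ x ∈ realPositiveIn ι, DenseLeftRight x) ∧
        (∃ x ∈ realPositiveIn ι, FullSupport LIM x) ∧
        (∃ x ∈ realPositive A, DenseInner x) ∧
        (∃ x ∈ realPositive A, DenseLeftRight x) ∧
        (∃ x ∈ realPositive A, FullSupport LIM x)) ∧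
      -- the case of operator algebras: `B` is a unital operator algebra on a Hilbert space `H`
      (∀ (H : Type w) [NormedAddCommGroup H] [InnerProductSpace ℂ H] [CompleteSpace H]
        (π : B →ₐ[ℂ] (H →L[ℂ] H)), Isometry π →
        (HasCai A → List.TFAE [
          ∃ x ∈ realPositiveIn ι, DenseInner x,
          ∃ x ∈ realPositiveIn ι, DenseLeftRight x,
          ∃ x ∈ realPositiveIn ι, FullSupport LIM x,
          ∃ e, IsSeqBaiIn (realPositiveIn ι) e,
          ∃ x, IsStrictlyRealPositive ι x]) ∧
        ((∃ x ∈ realPositiveIn ι, DenseInner x) ∨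
          (∃ x ∈ realPositiveIn ι, DenseLeftRight x) ∨
          (∃ x ∈ realPositiveIn ι, FullSupport LIM x) ∨
          (∃ e, IsSeqBaiIn (realPositiveIn ι) e) →
          (∃ x, IsStrictlyRealPositive ι x) ∧ ∃ e, IsSeqCaiIn (realPositiveIn ι) e)) := by
  have hii : (∃ x ∈ realPositive A, DenseInner x) ↔ ∃ x ∈ realPositive A, DenseLeftRight x := by
    simp only [denseInner_iff_denseLeftRight]
  have hiii : (∃ x ∈ realPositive A, FullSupport LIM x) ↔
      ∃ x ∈ realPositive A, DenseLeftRight x := by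
    refine exists_congr fun x => and_congr_right fun hx => ?_
    obtain ⟨B, _, _, _, _, ι, hι, hxι⟩ := hx
    exact fullSupport_iff_denseLeftRight hι hxι LIM
  refine ⟨by rw [hii, hiii]; tfae_finish, ?_⟩
  intro B _ _ _ _ ι hι
  have jii : (∃ x ∈ realPositiveIn ι, DenseInner x) ↔
      ∃ x ∈ realPositiveIn ι, DenseLeftRight x := by
    simp only [denseInner_iff_denseLeftRight]
  have jiii : (∃ x ∈ realPositiveIn ι, FullSupport LIM x) ↔
      ∃ x ∈ realPositiveIn ι, DenseLeftRight x :=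
    exists_congr fun x => and_congr_right fun hx => fullSupport_iff_denseLeftRight hι hx LIM
  have jiv : (∃ e, IsSeqBaiIn (realPositiveIn ι) e) ↔
      ∃ x ∈ realPositiveIn ι, DenseLeftRight x :=
    ⟨fun ⟨_, he⟩ => exists_denseLeftRight_of_isSeqBaiIn hι he,
      fun ⟨x, hx, h⟩ => ⟨rootSeq x, h.isSeqBaiIn_rootSeq hι hx⟩⟩
  refine ⟨by rw [jii, jiii, jiv]; tfae_finish, ?_, ?_, ?_⟩
  · intro x hx h
    rw [denseInner_iff_denseLeftRight, fullSupport_iff_denseLeftRight hι hx, or_self, or_self] at h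
    exact ⟨h.isSeqBaiIn_rootSeq hι hx, commute_rootSeq hι hx⟩
  · intro _ hb
    have h := exists_denseLeftRight_of_separable hι hb
    have h' : ∃ x ∈ realPositive A, DenseLeftRight x := by
      obtain ⟨x, hx, hd⟩ := h
      exact ⟨x, ⟨B, _, _, ‹_›, ‹_›, ι, hι, hx⟩, hd⟩
    exact ⟨jiv.2 h, jii.2 h, h, jiii.2 h, hii.2 h', h', hiii.2 h'⟩
  · intro H _ _ _ π hπ
    have hv : (∃ x ∈ realPositiveIn ι, DenseLeftRight x) → ∃ x, IsStrictlyRealPositive ι x :=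
      fun ⟨_, hx, h⟩ => ⟨_, isStrictlyRealPositive_resolventMul hι hπ hx h⟩
    refine ⟨fun hA => ?_, fun h => ?_⟩
    · have hv' : (∃ x, IsStrictlyRealPositive ι x) ↔
          ∃ x ∈ realPositiveIn ι, DenseLeftRight x :=
        ⟨fun ⟨x, hx⟩ => ⟨x, hx.mem_realPositiveIn, hx.denseLeftRight hι hπ hA⟩, hv⟩
      rw [jii, jiii, jiv, hv']
      tfae_finish
    · rw [jii, jiii, jiv, or_self, or_self, or_self] at h
      refine ⟨hv h, ?_⟩
      obtain ⟨x, hx, hd⟩ := h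
      exact exists_isSeqCaiIn hι hπ hx hd
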